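/- Let $p$ be a prime, $\mathbf k$ a field of characteristic $p$, $n=kp+a_0$ with $k\ge 1$ and $0\le a_0<p$, and let $\lambda=(\lambda_1,\dots,\lambda_r)\vdash a$, $\mu=(\mu_1,\dots,\mu_s)\vdash b$ be partitions with $a+b=n$. For a $(\lambda|\mu)$-tableau $t$ (a bijective filling of the rows of lengths $\lambda_1,\dots,\lambda_r,\mu_1,\dots,\mu_s$ with $1,\dots,n$) let $\epsilon(t)$ be the sign of the permutation that permutes letters within the $\mu$-rows of $t$ and makes these rows increasing. The signed permutation module $M=M^{(\lambda|\mu)}$ is the $\mathbf k$-space on all $(\lambda|\mu)$-tabloids $\{t\}$ (classes of tableaux under row equivalence), with $\mathcal S_n$ acting by $\pi\circ\{t\}=\epsilon(t)\epsilon(\pi t)\{\pi t\}$. For $1\le i\le k$ let $B_i=\{(i-1)p+1,\dots,ip\}$ and $\tau_i=((i-1)p+1,\dots,ip)$, and let $P=\langle\tau_1,\dots,\tau_k\rangle\le\mathcal S_n$. A tabloid $T$ is constituted by the blocks $\{B_i\}_{i\in I}$ if $I\subseteq\{1,\dots,k\}$ is the smallest set such that $\tau_j\circ T=\pm T$ for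 all $j\in\{1,\dots,k\}\setminus I$; write $I^T=I$. For a finite-dimensional $\mathbf kP$-module $N$, a core of $N$ is a submodule $C$ without nonzero projective direct summands such that $N=C\oplus Q$ with $Q$ projective; let $c_m(N)$ be the dimension of a core of $N^{\otimes m}$ and $\gamma_P(N)=\lim_{m\to\infty}c_m(N)^{1/m}$. **Theorem.** Choose a representative $t_\alpha$ of each $P$-orbit $\alpha$ of tabloids, and let $A_\alpha=\mathbf kP\circ t_\alpha$ and $d_\alpha=|I^{t_\alpha}|$. Then: 1. The restriction of $M$ to $P$ is $\bigoplus_\alpha A_\alpha$. Each $A_\alpha$ is indecomposable of dimension $p^{d_\alpha}$, and is spanned over $\mathbf k$ by the tabloids of the orbit $\alpha$, all of which are constituted by the same blocks as $t_\alpha$. 2. Let $\mathcal I$ be the set of those $\alpha$ for which $A_\alpha$ is not projective. Then $\bigoplus_{\alpha\in\mathcal I}A_\alpha$ is a core of the restriction of $M$ to $P$. 3. Let $J_0$ be the largest subset of $\mathcal I$ such that for every $\alpha\in J_0$ the blocks constituting $t_\alpha$ lie in $\{B_1,\dots,B_{k-1}\}$. Then the limit $\gamma_P(M)$ exists (each $M^{\otimes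 m}$ has a core, and the limit does not depend on the choice of cores) and $$\gamma_P(M)=\sum_{\alpha\in J_0}p^{d_\alpha}=\#\{T \text{ a } (\lambda|\mu)\text{-tabloid} : \tau_k\circ T=\pm T\}.$$ -/

import Mathlib

open Filter Topology
open scoped TensorProduct

namespace SignedPerm

noncomputable section

/-! ### Cores and the Benson-Symonds invariant -/

section Core

variable {R M : Type*} [Semiring R] [AddCommMonoid M] [Module R M]

/-- A submodule `N` is indecomposable: it is nonzero and is not the (internal) direct sum of two
nonzero submodules. -/
def IsIndecomposable (N : Submodule R M) : Prop :=
  N ≠ ⊥ ∧ ∀ A B : Submodule R M, Disjoint A B → A ⊔ B = N → A = ⊥ ∨ B = ⊥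

/-- `N` is a core of `M`: `M = N ⊕ Q` with `Q` projective, and `N` has no nonzero projective
direct summand. -/
def IsCore (N : Submodule R M) : Prop :=
  (∃ Q : Submodule R M, IsCompl N Q ∧ Module.Projective R Q) ∧
    ∀ A B : Submodule R M, Disjoint A B → A ⊔ B = N → Module.Projective R A → A = ⊥

end Core

section BensonSymonds

variable {K G V : Type*} [Field K] [Group G] [AddCommGroup V] [Module K V]

/-- The `n`-th tensor power of a representation, with the diagonal action
`g (v₁ ⊗ ⋯ ⊗ vₙ) = g v₁ ⊗ ⋯ ⊗ g vₙ`. -/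
def tensorPower (ρ : Representation K G V) (n : ℕ) :
    Representation K G (⨂[K] _ : Fin n, V) where
  toFun g := PiTensorProduct.map fun _ => ρ g
  map_one' := by
    rw [map_one]
    exact PiTensorProduct.map_one
  map_mul' a b := by
    rw [map_mul]
    exact PiTensorProduct.map_mul _ _

/-- The `K`-dimension of a submodule of the `KG`-module of a representation. -/
def dimension {ρ : Representation K G V} (N : Submodule (MonoidAlgebra K G) ρ.asModule) : ℕ :=
  Module.finrank K (N.restrictScalars K)

/-- `γ_G(ρ) = γ`: every tensor power `ρ^{⊗ n}` has a core, and, `cₙ` being the dimension of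
a core of `ρ^{⊗ n}`, the `n`-th root of `cₙ` tends to `γ` as `n → ∞`. -/
def HasBensonSymondsInvariant (ρ : Representation K G V) (γ : ℝ) : Prop :=
  (∀ n : ℕ, ∃ C : Submodule (MonoidAlgebra K G) (tensorPower ρ n).asModule, IsCore C) ∧
    ∀ C : ∀ n : ℕ, Submodule (MonoidAlgebra K G) (tensorPower ρ n).asModule,
      (∀ n, IsCore (C n)) →
        Tendsto (fun n : ℕ => (dimension (C n) : ℝ) ^ (1 / (n : ℝ))) atTop (𝓝 γ)

end BensonSymonds

/-! ### Tableaux, tabloids and the signed permutation module -/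

/-- `f = (f₁ ≥ f₂ ≥ ⋯ ≥ f_r > 0)` is a partition (of `∑ i, f i`). -/
def IsPartition {r : ℕ} (f : Fin r → ℕ) : Prop := Antitone f ∧ ∀ i, 0 < f i

section Tableaux

theorem perm_apply_inv {α : Type*} (π : Equiv.Perm α) (x : α) : π (π⁻¹ x) = x :=
  π.apply_symm_apply x

theorem perm_inv_apply {α : Type*} (π : Equiv.Perm α) (x : α) : π⁻¹ (π x) = x :=
  π.symm_apply_apply x

variable {r s : ℕ}

/-- The cells of the shape `(λ₁, …, λ_r, μ₁, …, μ_s)`: the `λ`-rows are indexed by `Fin r`, the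
`μ`-rows by `Fin s`. -/
abbrev Cell (lam : Fin r → ℕ) (mu : Fin s → ℕ) : Type :=
  Σ i : Fin r ⊕ Fin s, Fin (Sum.elim lam mu i)

/-- A `(λ|μ)`-tableau: a bijective filling of the cells by the `n` letters. -/
structure Tableau (lam : Fin r → ℕ) (mu : Fin s → ℕ) (n : ℕ) : Type where
  /-- The bijection from the cells to the letters. -/
  filling : Cell lam mu ≃ Fin n

variable {lam : Fin r → ℕ} {mu : Fin s → ℕ} {n : ℕ}

namespace Tableau

/-- The entry of a tableau in a cell. -/
def entry (t : Tableau lam mu n) (c : Cell lam mu) : Fin n := t.filling c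

/-- The row of a tableau that contains a given letter. -/
def row (t : Tableau lam mu n) (x : Fin n) : Fin r ⊕ Fin s := (t.filling.symm x).1

/-- The symmetric group acts on tableaux through the entries. -/
instance : MulAction (Equiv.Perm (Fin n)) (Tableau lam mu n) where
  smul π t := ⟨t.filling.trans π⟩
  one_smul _ := rfl
  mul_smul _ _ _ := rfl

theorem entry_smul (π : Equiv.Perm (Fin n)) (t : Tableau lam mu n) (c : Cell lam mu) :
    (π • t).entry c = π (t.entry c) := rfl

theorem row_smul (π : Equiv.Perm (Fin n)) (t : Tableau lam mu n) (x : Fin n) :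
    (π • t).row x = t.row (π⁻¹ x) := rfl

theorem row_entry (t : Tableau lam mu n) (c : Cell lam mu) : t.row (t.entry c) = c.1 :=
  congrArg Sigma.fst (t.filling.symm_apply_apply c)

theorem exists_entry (t : Tableau lam mu n) (x : Fin n) : ∃ c, t.entry c = x ∧ c.1 = t.row x :=
  ⟨t.filling.symm x, t.filling.apply_symm_apply x, rfl⟩

theorem entry_injective (t : Tableau lam mu n) : Function.Injective t.entry :=
  t.filling.injective

/-- The row stabilizer `R_t`. -/
def rowStabilizer (t : Tableau lam mu n) : Subgroup (Equiv.Perm (Fin n)) where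
  carrier := {ρ | ∀ x, t.row (ρ x) = t.row x}
  one_mem' _ := rfl
  mul_mem' {a b} ha hb x := (ha (b x)).trans (hb x)
  inv_mem' {a} ha x := by
    have := ha (a⁻¹ x)
    rw [perm_apply_inv] at this
    exact this.symm

theorem mem_rowStabilizer {t : Tableau lam mu n} {ρ : Equiv.Perm (Fin n)} :
    ρ ∈ t.rowStabilizer ↔ ∀ x, t.row (ρ x) = t.row x := Iff.rfl

/-- The subgroup `R_{t,μ}` of `R_t` of those elements that only move letters of the `μ`-rows. -/
def muRowStabilizer (t : Tableau lam mu n) : Subgroup (Equiv.Perm (Fin n)) where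
  carrier := {ρ | ρ ∈ t.rowStabilizer ∧ ∀ x i, t.row x = Sum.inl i → ρ x = x}
  one_mem' := ⟨one_mem _, fun _ _ _ => rfl⟩
  mul_mem' {a b} ha hb := ⟨mul_mem ha.1 hb.1, fun x i hx => by
    rw [Equiv.Perm.mul_apply, hb.2 x i hx, ha.2 x i hx]⟩
  inv_mem' {a} ha := ⟨inv_mem ha.1, fun x i hx => by
    rw [Equiv.Perm.inv_eq_iff_eq, ha.2 x i hx]⟩

theorem mem_muRowStabilizer {t : Tableau lam mu n} {ρ : Equiv.Perm (Fin n)} :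
    ρ ∈ t.muRowStabilizer ↔
      (∀ x, t.row (ρ x) = t.row x) ∧ ∀ x i, t.row x = Sum.inl i → ρ x = x := Iff.rfl

/-- The `μ`-rows of `t` are increasing. -/
def IsMuRowStandard (t : Tableau lam mu n) : Prop :=
  ∀ j : Fin s, StrictMono fun c : Fin (mu j) => t.entry ⟨Sum.inr j, c⟩

/-- The permutation of the cells that sorts the `μ`-rows of `t`. -/
def cellSort (t : Tableau lam mu n) : Equiv.Perm (Cell lam mu) :=
  Equiv.sigmaCongrRight fun i => match i with
    | Sum.inl _ => Equiv.refl _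
    | Sum.inr j => Tuple.sort fun c : Fin (mu j) => t.entry ⟨Sum.inr j, c⟩

/-- The permutation `ρ ∈ R_{t,μ}` such that `ρ t` has increasing `μ`-rows. -/
def sortPerm (t : Tableau lam mu n) : Equiv.Perm (Fin n) := t.filling.permCongr t.cellSort

/-- The sign `ε(t)`: the sign of the `ρ ∈ R_{t,μ}` for which `ρ t` has increasing `μ`-rows
(see `epsilon_eq`). -/
def epsilon (t : Tableau lam mu n) : ℤˣ := Equiv.Perm.sign t.sortPerm

theorem sortPerm_entry (t : Tableau lam mu n) (c : Cell lam mu) :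
    t.sortPerm (t.entry c) = t.entry (t.cellSort c) := by
  simp [sortPerm, entry]

theorem sortPerm_mem (t : Tableau lam mu n) : t.sortPerm ∈ t.muRowStabilizer := by
  refine ⟨fun x => ?_, fun x i hx => ?_⟩
  · obtain ⟨c, rfl, -⟩ := t.exists_entry x
    rw [sortPerm_entry, row_entry, row_entry]
    rfl
  · obtain ⟨⟨i', c⟩, rfl, hc⟩ := t.exists_entry x
    rw [sortPerm_entry]
    rw [row_entry] at hx
    cases hx
    rfl

theorem sortPerm_standard (t : Tableau lam mu n) : (t.sortPerm • t).IsMuRowStandard := by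
  intro j
  have h : (fun c : Fin (mu j) => (t.sortPerm • t).entry ⟨Sum.inr j, c⟩) =
      (fun c : Fin (mu j) => t.entry ⟨Sum.inr j, c⟩) ∘
        (Tuple.sort fun c : Fin (mu j) => t.entry ⟨Sum.inr j, c⟩) := by
    funext c
    rw [entry_smul, sortPerm_entry]
    rfl
  refine Monotone.strictMono_of_injective (h ▸ Tuple.monotone_sort _) ?_
  intro a b hab
  have := entry_injective _ hab
  exact eq_of_heq (Sigma.mk.inj this).2

theorem sort_unique {t : Tableau lam mu n} {ρ σ : Equiv.Perm (Fin n)}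
    (hρ : ρ ∈ t.muRowStabilizer) (hσ : σ ∈ t.muRowStabilizer)
    (hρs : (ρ • t).IsMuRowStandard) (hσs : (σ • t).IsMuRowStandard) : ρ = σ := by
  have key : ∀ {ρ : Equiv.Perm (Fin n)}, ρ ∈ t.muRowStabilizer → ∀ j : Fin s,
      Set.range (fun c : Fin (mu j) => (ρ • t).entry ⟨Sum.inr j, c⟩) =
        {x | t.row x = Sum.inr j} := by
    intro ρ hρ j
    ext x
    constructor
    · rintro ⟨c, rfl⟩
      change t.row (ρ (t.entry _)) = _
      rw [hρ.1, row_entry]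
    · intro hx
      have hx' : t.row (ρ⁻¹ x) = Sum.inr j := by
        rw [(inv_mem hρ).1 x]; exact hx
      obtain ⟨⟨i, c⟩, hc, hi⟩ := t.exists_entry (ρ⁻¹ x)
      rw [hx'] at hi
      cases hi
      refine ⟨c, ?_⟩
      change ρ (t.entry _) = x
      rw [hc, perm_apply_inv]
  ext1 x
  obtain ⟨⟨i, c⟩, rfl, -⟩ := t.exists_entry x
  cases i with
  | inl i => rw [hρ.2 _ i (row_entry _ _), hσ.2 _ i (row_entry _ _)]
  | inr j =>
    have h := ((hρs j).range_inj (hσs j)).1 ((key hρ j).trans (key hσ j).symm)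
    exact congrFun h c

theorem epsilon_eq {t : Tableau lam mu n} {ρ : Equiv.Perm (Fin n)}
    (hρ : ρ ∈ t.muRowStabilizer) (hs : (ρ • t).IsMuRowStandard) :
    t.epsilon = Equiv.Perm.sign ρ := by
  rw [sort_unique hρ t.sortPerm_mem hs t.sortPerm_standard, epsilon]

/-- `ε(t)` depends only on the `μ`-part of `t`. -/
theorem epsilon_congr {t u : Tableau lam mu n}
    (h : ∀ j (c : Fin (mu j)), t.entry ⟨Sum.inr j, c⟩ = u.entry ⟨Sum.inr j, c⟩) :
    t.epsilon = u.epsilon := by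
  have : t.cellSort = u.cellSort := by
    unfold cellSort
    congr 1
    funext i
    cases i with
    | inl i => rfl
    | inr j =>
      change Tuple.sort _ = Tuple.sort _
      congr 1
      funext c
      exact h j c
  unfold epsilon sortPerm
  rw [Equiv.Perm.sign_permCongr, Equiv.Perm.sign_permCongr, this]

theorem epsilon_smul_mu {t : Tableau lam mu n} {ρ : Equiv.Perm (Fin n)}
    (hρ : ρ ∈ t.muRowStabilizer) (π : Equiv.Perm (Fin n)) :
    (π • ρ • t).epsilon = Equiv.Perm.sign ρ * (π • t).epsilon := by
  set σ := (π • t).sortPerm with hσ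
  have hσm := (π • t).sortPerm_mem
  rw [← hσ, mem_muRowStabilizer] at hσm
  have hρ' := inv_mem hρ
  rw [mem_muRowStabilizer] at hρ'
  have hmem : σ * π * ρ⁻¹ * π⁻¹ ∈ (π • ρ • t).muRowStabilizer := by
    have e : ∀ x, (π • ρ • t).row x = (π • t).row x := fun x => hρ'.1 (π⁻¹ x)
    refine mem_muRowStabilizer.2 ⟨fun x => ?_, fun x i hx => ?_⟩
    · rw [e, e]
      simp only [Equiv.Perm.mul_apply]
      rw [hσm.1, row_smul, perm_inv_apply, hρ'.1, row_smul]
    · rw [e] at hx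
      simp only [Equiv.Perm.mul_apply]
      rw [hρ'.2 _ i (by rwa [row_smul] at hx), perm_apply_inv, hσm.2 _ i hx]
  have hst : ((σ * π * ρ⁻¹ * π⁻¹) • π • ρ • t).IsMuRowStandard := by
    have : (σ * π * ρ⁻¹ * π⁻¹) • π • ρ • t = σ • π • t := by
      simp only [smul_smul]
      congr 1
      group
    rw [this]
    exact (π • t).sortPerm_standard
  rw [epsilon_eq hmem hst, epsilon, ← hσ]
  simp only [map_mul, Equiv.Perm.sign_inv]
  rw [mul_comm (Equiv.Perm.sign σ) (Equiv.Perm.sign π), mul_assoc, mul_assoc, mul_comm,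
    mul_assoc, mul_assoc, Int.units_mul_self, mul_one, mul_comm]

theorem epsilon_mul_epsilon {t : Tableau lam mu n} {ρ : Equiv.Perm (Fin n)}
    (hρ : ρ ∈ t.rowStabilizer) (π : Equiv.Perm (Fin n)) :
    (ρ • t).epsilon * (π • ρ • t).epsilon = t.epsilon * (π • t).epsilon := by
  classical
  let q : Fin n → Prop := fun x => (t.row x).isRight = true
  have hq : ∀ x, q (ρ x) ↔ q x := fun x => by
    change (t.row (ρ x)).isRight = true ↔ _
    rw [hρ x]
  let ρ' : Equiv.Perm (Fin n) := Equiv.Perm.ofSubtype (ρ.subtypePerm hq)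
  have h1 : ∀ x, q x → ρ' x = ρ x := fun x hx => by
    change Equiv.Perm.ofSubtype (ρ.subtypePerm hq) x = ρ x
    rw [Equiv.Perm.ofSubtype_apply_of_mem _ hx]
    rfl
  have h2 : ∀ x, ¬ q x → ρ' x = x := fun x hx => Equiv.Perm.ofSubtype_apply_of_not_mem _ hx
  have hρ' : ρ' ∈ t.muRowStabilizer := by
    refine mem_muRowStabilizer.2 ⟨fun x => ?_, fun x i hx => ?_⟩
    · by_cases hx : q x
      · rw [h1 x hx, hρ x]
      · rw [h2 x hx]
    · refine h2 x ?_
      change ¬ (t.row x).isRight = true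
      rw [hx]
      simp
  have hag : ∀ (τ : Equiv.Perm (Fin n)), (τ • ρ • t).epsilon = (τ • ρ' • t).epsilon := by
    intro τ
    refine epsilon_congr fun j c => ?_
    simp only [entry_smul]
    rw [h1]
    change (t.row (t.entry _)).isRight = true
    rw [row_entry]
    rfl
  have hone := hag 1
  have e1 := epsilon_smul_mu hρ' 1
  simp only [one_smul] at hone e1
  rw [hone, hag π, e1, epsilon_smul_mu hρ' π, mul_mul_mul_comm, Int.units_mul_self, one_mul]

/-- Two tableaux are equivalent if they differ by an element of the row stabilizer. -/
instance rowSetoid (lam : Fin r → ℕ) (mu : Fin s → ℕ) (n : ℕ) : Setoid (Tableau lam mu n) where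
  r t u := ∃ ρ ∈ t.rowStabilizer, u = ρ • t
  iseqv :=
    { refl := fun t => ⟨1, one_mem _, (one_smul _ t).symm⟩
      symm := by
        rintro t _ ⟨ρ, hρ, rfl⟩
        refine ⟨ρ⁻¹, fun x => ?_, (inv_smul_smul ρ t).symm⟩
        rw [row_smul, row_smul, inv_mem hρ]
      trans := by
        rintro t _ _ ⟨ρ, hρ, rfl⟩ ⟨σ, hσ, rfl⟩
        refine ⟨σ * ρ, fun x => ?_, (mul_smul σ ρ t).symm⟩
        have h := hσ (ρ x)
        rw [row_smul, row_smul, perm_inv_apply, inv_mem hρ] at h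
        exact h }

theorem equiv_smul (π : Equiv.Perm (Fin n)) {t u : Tableau lam mu n} (h : t ≈ u) :
    π • t ≈ π • u := by
  obtain ⟨ρ, hρ, rfl⟩ := h
  refine ⟨π * ρ * π⁻¹, fun x => ?_, ?_⟩
  · rw [row_smul, row_smul]
    simp only [Equiv.Perm.mul_apply, perm_inv_apply]
    exact hρ _
  · simp only [smul_smul]
    congr 1
    group

end Tableau

/-- A `(λ|μ)`-tabloid: a class of tableaux under row equivalence. -/
def Tabloid (lam : Fin r → ℕ) (mu : Fin s → ℕ) (n : ℕ) : Type :=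
  Quotient (Tableau.rowSetoid lam mu n)

namespace Tabloid

instance : Finite (Tableau lam mu n) :=
  Finite.of_injective Tableau.filling fun ⟨_⟩ ⟨_⟩ h => congrArg Tableau.mk h

instance : Finite (Tabloid lam mu n) :=
  inferInstanceAs (Finite (Quotient (Tableau.rowSetoid lam mu n)))

/-- The (unsigned) action `π {t} = {π t}`. -/
instance : MulAction (Equiv.Perm (Fin n)) (Tabloid lam mu n) where
  smul π := Quotient.map (π • ·) fun _ _ h => Tableau.equiv_smul π h
  one_smul := by rintro ⟨t⟩; rfl
  mul_smul π σ := by rintro ⟨t⟩; rfl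

/-- The sign `ε(t) ε(π t)` with which `π` acts on the tabloid `{t}`. -/
def actionSign (π : Equiv.Perm (Fin n)) : Tabloid lam mu n → ℤˣ :=
  Quotient.lift (fun t : Tableau lam mu n => t.epsilon * (π • t).epsilon) (by
    rintro t _ ⟨ρ, hρ, rfl⟩
    exact (Tableau.epsilon_mul_epsilon hρ π).symm)

theorem actionSign_one (T : Tabloid lam mu n) : actionSign 1 T = 1 := by
  obtain ⟨t⟩ := T
  exact Int.units_mul_self _

theorem actionSign_mul (π σ : Equiv.Perm (Fin n)) (T : Tabloid lam mu n) :
    actionSign (π * σ) T = actionSign σ T * actionSign π (σ • T) := by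
  obtain ⟨t⟩ := T
  change t.epsilon * (π • σ • t).epsilon =
    (t.epsilon * (σ • t).epsilon) * ((σ • t).epsilon * (π • σ • t).epsilon)
  rw [mul_assoc, ← mul_assoc (σ • t).epsilon, Int.units_mul_self, one_mul]

end Tabloid

variable (K : Type*) [Field K] (lam mu n)

/-- The signed permutation module `M^{(λ|μ)}`: the vector space on all `(λ|μ)`-tabloids, with the
signed action `π ∘ {t} = ε(t) ε(π t) {π t}` of the symmetric group. -/
def signedModule : Representation K (Equiv.Perm (Fin n)) (Tabloid lam mu n →₀ K) where
  toFun π := Finsupp.linearCombination K fun T : Tabloid lam mu n =>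
    Finsupp.single (π • T) (((Tabloid.actionSign π T : ℤˣ) : ℤ) : K)
  map_one' := by
    ext T : 2
    simp [Tabloid.actionSign_one]
  map_mul' π σ := by
    refine Finsupp.lhom_ext' fun T => LinearMap.ext_ring ?_
    simp [Tabloid.actionSign_mul, mul_smul]

theorem signedModule_single (π : Equiv.Perm (Fin n)) (T : Tabloid lam mu n) :
    signedModule lam mu n K π (Finsupp.single T 1) =
      Finsupp.single (π • T) (((Tabloid.actionSign π T : ℤˣ) : ℤ) : K) := by
  simp [signedModule]

end Tableaux

/-! ### The elementary abelian subgroup `P`, blocks and orbits -/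

section Blocks

variable (p k a₀ : ℕ)

/-- The `j`-th element (`0 ≤ j < p`) of the block `B_{i+1} = {ip + 1, …, ip + p}`; the letters
`1, …, n` are represented by `0, …, n - 1`. -/
def blockEntry (i : Fin k) (j : Fin p) : Fin (k * p + a₀) :=
  ⟨i * p + j, by
    have h : (i + 1) * p ≤ k * p := Nat.mul_le_mul_right p i.isLt
    have := j.isLt
    rw [add_mul, one_mul] at h
    omega⟩

/-- The `p`-cycle `τ_{i+1} = (ip + 1, …, ip + p)`. -/
def tau (i : Fin k) : Equiv.Perm (Fin (k * p + a₀)) :=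
  (List.ofFn (blockEntry p k a₀ i)).formPerm

/-- The subgroup `P = ⟨τ₁, …, τ_k⟩`. -/
def cycleGroup : Subgroup (Equiv.Perm (Fin (k * p + a₀))) :=
  Subgroup.closure (Set.range (tau p k a₀))

variable {p k a₀} {r s : ℕ} (K : Type*) [Field K] {lam : Fin r → ℕ} {mu : Fin s → ℕ}

/-- The tabloid `T` is fixed up to sign by `π`: `π ∘ T = ± T` in `M^{(λ|μ)}`. -/
def FixedUpToSign {n : ℕ} (π : Equiv.Perm (Fin n)) (T : Tabloid lam mu n) : Prop :=
  signedModule lam mu n K π (Finsupp.single T 1) = Finsupp.single T 1 ∨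
    signedModule lam mu n K π (Finsupp.single T 1) = -Finsupp.single T 1

open Classical in
/-- The index set `I^T` of the blocks that constitute `T`: the smallest `I ⊆ {1, …, k}` with
`τ_j ∘ T = ± T` for all `j ∉ I` (see `isLeast_constitutingBlocks`). -/
def constitutingBlocks (T : Tabloid lam mu (k * p + a₀)) : Finset (Fin k) :=
  Finset.univ.filter fun j => ¬ FixedUpToSign K (tau p k a₀ j) T

theorem isLeast_constitutingBlocks (T : Tabloid lam mu (k * p + a₀)) :
    IsLeast {I : Finset (Fin k) | ∀ j, j ∉ I → FixedUpToSign K (tau p k a₀ j) T}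
      (constitutingBlocks K T) := by
  constructor
  · intro j hj
    simpa [constitutingBlocks] using hj
  · intro I hI j hj
    by_contra h
    simp only [constitutingBlocks, Finset.mem_filter] at hj
    exact hj.2 (hI j h)

variable (p k a₀ lam mu)

/-- The restriction `M_P` of the signed permutation module to `P`. -/
def restrictedModule :
    Representation K (cycleGroup p k a₀) (Tabloid lam mu (k * p + a₀) →₀ K) :=
  (signedModule lam mu (k * p + a₀) K).comp (cycleGroup p k a₀).subtype

/-- The set of `P`-orbits of tabloids. -/
abbrev TabloidOrbit : Type :=
  MulAction.orbitRel.Quotient (cycleGroup p k a₀) (Tabloid lam mu (k * p + a₀))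

/-- The set of `P`-orbits of tabloids is finite. -/
instance : Fintype (TabloidOrbit p k a₀ lam mu) :=
  @Fintype.ofFinite _ (Quotient.finite _)

variable {p k a₀ lam mu}

/-- The cyclic `KP`-submodule `⟨T⟩` of `M_P` generated by a tabloid `T`. -/
def cyclicSubmodule (T : Tabloid lam mu (k * p + a₀)) :
    Submodule (MonoidAlgebra K (cycleGroup p k a₀)) (restrictedModule p k a₀ K lam mu).asModule :=
  Submodule.span _ {(restrictedModule p k a₀ K lam mu).asModuleEquiv.symm (Finsupp.single T 1)}

end Blocks

end

end SignedPerm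

namespace SignedPerm

/-! ### Group algebras of commutative groups of exponent `p` in characteristic `p` -/

section GroupAlgebra

variable {K G : Type*} [Field K] [Group G]

/-! Since `P` is commutative of exponent `p` and the characteristic is `p`, the `p`-th power of an
element of `KP` is the `p`-th power of its augmentation. Hence `KP` is local, finitely generated
projective modules are free, and nonzero cyclic modules are indecomposable. The sum of all group
elements (the norm element) detects free summands: a vector that it does not kill generates a free
direct summand (`exists_linearMap_eq_one`), and a finite-dimensional projective module that it kills
is zero. So a complement of a projective submodule is a core exactly when the norm element kills it,
and the dimension of a core is determined by the rank of the norm element.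

The tabloids form a basis of `M` that `P` permutes up to sign. A scalar by which an element of `P`
acts on a basis vector whose index it fixes is a `p`-th root of unity, hence 1, so the signs do not
affect stabilizers. A free orbit spans a free module, and any other orbit is killed by the norm
element. Thus the basis vectors with nontrivial stabilizer span a core (`IsMonomial.isCore`).

The tensor power `M^{⊗m}` is again monomial, on `m`-tuples of tabloids. A nontrivial `h ∈ P` acts on
some block as a nontrivial power of its cycle `τ_i`, and every tabloid fixed by `h` is then fixed by
`τ_i`. So the tuples with nontrivial stabilizer form the union of the fixed sets of `τ_1, …, τ_k`.
The `τ_i` are conjugate in the symmetric group, so each fixes the same number `f` of tabloids and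
`f^m` tuples. Therefore `f^m ≤ c_m ≤ k f^m`, and the `m`-th root of `c_m` tends to `f`. Sorting the
fixed tabloids of `τ_k` into orbits, of size `p^{d_α}`, gives the sum over `J₀`. -/

/-- The augmentation `KG → K`. -/
noncomputable def augmentation (K G : Type*) [Field K] [Group G] : MonoidAlgebra K G →ₐ[K] K :=
  MonoidAlgebra.lift K K G 1

theorem augmentation_single (g : G) (a : K) :
    augmentation K G (MonoidAlgebra.single g a) = a := by
  simp [augmentation]

/-- The commutative ring structure of the group algebra of a commutative group. -/
@[reducible]
noncomputable def groupAlgebraCommRing (K : Type*) [Field K] (hG : ∀ a b : G, a * b = b * a) :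
    CommRing (MonoidAlgebra K G) where
  __ := (inferInstance : Ring (MonoidAlgebra K G))
  mul_comm x y := by
    refine MonoidAlgebra.induction_linear x (by simp) (fun x y hx hy => ?_) (fun g a => ?_)
    · rw [add_mul, mul_add, hx, hy]
    · refine MonoidAlgebra.induction_linear y (by simp) (fun x y hx hy => ?_) (fun h b => ?_)
      · rw [add_mul, mul_add, hx, hy]
      · rw [MonoidAlgebra.single_mul_single, MonoidAlgebra.single_mul_single, hG, mul_comm a]

/-- Frobenius is additive on the commutative ring `KG` of characteristic `p`, and it sends every
group element to 1. -/
theorem pow_eq_algebraMap_augmentation {p : ℕ} [Fact p.Prime] [CharP K p]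
    (hG : ∀ a b : G, a * b = b * a) (hp : ∀ g : G, g ^ p = 1) (x : MonoidAlgebra K G) :
    x ^ p = algebraMap K _ (augmentation K G x ^ p) := by
  let := groupAlgebraCommRing K hG
  have : CharP (MonoidAlgebra K G) p :=
    charP_of_injective_algebraMap (algebraMap K (MonoidAlgebra K G)).injective p
  refine MonoidAlgebra.induction_linear x ?_ (fun x y hx hy => ?_) (fun g a => ?_)
  · have := (Fact.out : p.Prime).ne_zero
    simp [this]
  · rw [map_add, add_pow_char, add_pow_char, map_add, ← hx, ← hy]
  · rw [MonoidAlgebra.single_pow, hp, augmentation_single]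
    rfl

/-- The `p`-th power of `x` is a nonzero scalar. Thus the nonunits are the kernel of the
augmentation, and `KG` is local. -/
theorem isUnit_of_augmentation_ne_zero {p : ℕ} [Fact p.Prime] [CharP K p]
    (hG : ∀ a b : G, a * b = b * a) (hp : ∀ g : G, g ^ p = 1) {x : MonoidAlgebra K G}
    (hx : augmentation K G x ≠ 0) : IsUnit x := by
  have h : IsUnit (x ^ p) := by
    rw [pow_eq_algebraMap_augmentation hG hp]
    exact (IsUnit.mk0 _ (pow_ne_zero _ hx)).map _
  exact (isUnit_pow_iff (Fact.out : p.Prime).ne_zero).1 h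

theorem free_of_projective {p : ℕ} [Fact p.Prime] [CharP K p]
    (hG : ∀ a b : G, a * b = b * a) (hp : ∀ g : G, g ^ p = 1)
    {Q : Type*} [AddCommGroup Q] [Module (MonoidAlgebra K G) Q]
    [Module.Finite (MonoidAlgebra K G) Q] [Module.Projective (MonoidAlgebra K G) Q] :
    Module.Free (MonoidAlgebra K G) Q := by
  let := groupAlgebraCommRing K hG
  have : IsLocalRing (MonoidAlgebra K G) := by
    have key : ∀ a : MonoidAlgebra K G, a ∈ nonunits (MonoidAlgebra K G) →
        augmentation K G a = 0 := fun a ha => by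
      by_contra h
      exact ha (isUnit_of_augmentation_ne_zero hG hp h)
    refine IsLocalRing.of_nonunits_add fun a b ha hb hab => ?_
    have h := hab.map (augmentation K G)
    rw [map_add, key a ha, key b hb, add_zero] at h
    exact not_isUnit_zero h
  exact Module.free_of_flat_of_isLocalRing

theorem finite_submodule {N : Type*} [AddCommGroup N] [Module K N]
    [Module (MonoidAlgebra K G) N] [IsScalarTower K (MonoidAlgebra K G) N] [Module.Finite K N]
    (C : Submodule (MonoidAlgebra K G) N) :
    Module.Finite (MonoidAlgebra K G) C :=
  have : Module.Finite K C :=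
    (inferInstance : Module.Finite K (C.restrictScalars K))
  Module.Finite.of_restrictScalars_finite K _ _

/-- A cyclic module over the group algebra is indecomposable. -/
theorem isIndecomposable_span_singleton {N : Type*} [AddCommGroup N]
    [Module (MonoidAlgebra K G) N] {p : ℕ} [Fact p.Prime] [CharP K p]
    (hG : ∀ a b : G, a * b = b * a) (hp : ∀ g : G, g ^ p = 1) {v : N} (hv : v ≠ 0) :
    IsIndecomposable (Submodule.span (MonoidAlgebra K G) {v}) := by
  refine ⟨by rwa [Ne, Submodule.span_singleton_eq_bot], ?_⟩
  have key : ∀ (A B : Submodule (MonoidAlgebra K G) N), Disjoint A B →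
      A ⊔ B = Submodule.span (MonoidAlgebra K G) {v} → ∀ r : MonoidAlgebra K G, r • v ∈ A →
      augmentation K G r ≠ 0 → B = ⊥ := by
    intro A B hd hAB r hr hε
    have hvA : v ∈ A := by
      obtain ⟨u, rfl⟩ := isUnit_of_augmentation_ne_zero hG hp hε
      have := A.smul_mem (↑u⁻¹ : MonoidAlgebra K G) hr
      rwa [← mul_smul, Units.inv_mul, one_smul] at this
    have hBA : B ≤ A := (le_sup_right.trans hAB.le).trans
      ((Submodule.span_singleton_le_iff_mem _ _).2 hvA)
    exact disjoint_self.1 (hd.mono_left hBA)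
  intro A B hd hAB
  obtain ⟨a, ha, c, hc, hac⟩ := Submodule.mem_sup.1
    (hAB ▸ Submodule.mem_span_singleton_self v : v ∈ A ⊔ B)
  obtain ⟨x, rfl⟩ := Submodule.mem_span_singleton.1 (hAB ▸ Submodule.mem_sup_left ha)
  obtain ⟨y, rfl⟩ := Submodule.mem_span_singleton.1 (hAB ▸ Submodule.mem_sup_right hc)
  -- With `v = x v + y v`, a summand whose coefficient is a unit contains `v` and hence is
  -- everything. If both augmentations vanished, `1 - (x + y)` would be a unit that kills `v`.
  by_cases hx : augmentation K G x = 0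
  · by_cases hy : augmentation K G y = 0
    · exfalso
      have hu : IsUnit (1 - (x + y)) := isUnit_of_augmentation_ne_zero hG hp (by simp [hx, hy])
      have h0 : (1 - (x + y)) • v = 0 := by rw [sub_smul, add_smul, hac, one_smul, sub_self]
      exact hv ((hu.smul_eq_zero).1 h0)
    · exact Or.inl (key B A hd.symm (sup_comm A B ▸ hAB) y hc hy)
  · exact Or.inr (key A B hd hAB x ha hx)

/-! ### The norm element, free summands and the dimension of cores -/

section Norm

variable [Fintype G]

/-- The sum of all elements of `G` in `KG`. -/
noncomputable def normElement (K G : Type*) [Field K] [Group G] [Fintype G] : MonoidAlgebra K G :=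
  ∑ g, MonoidAlgebra.single g 1

theorem normElement_ne_zero : normElement K G ≠ 0 := fun h => by
  have := congrArg (fun x : MonoidAlgebra K G => x.coeff 1) h
  simp [normElement, MonoidAlgebra.coeff_sum, Finsupp.finsetSum_apply] at this

/-- Right translation by a group element permutes the terms of the norm element. -/
theorem normElement_mul (x : MonoidAlgebra K G) :
    normElement K G * x = augmentation K G x • normElement K G := by
  refine MonoidAlgebra.induction_linear x (by simp) (fun x y hx hy => ?_) (fun g a => ?_)
  · rw [mul_add, hx, hy, map_add, add_smul]
  · rw [normElement, Finset.sum_mul, Finset.smul_sum, augmentation_single]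
    refine Fintype.sum_equiv (Equiv.mulRight g) _ _ fun h => ?_
    simp [MonoidAlgebra.single_mul_single, MonoidAlgebra.smul_single]

variable {N : Type*} [AddCommGroup N] [Module K N] [Module (MonoidAlgebra K G) N]
  [IsScalarTower K (MonoidAlgebra K G) N]

/-- A functional `f` that does not vanish on the norm multiple of `v` induces the equivariant map `n
↦ ∑ f(g⁻¹ n) g`. Its value at `v` has augmentation `f (normElement K G • v) ≠ 0`, so it is a unit
and can be scaled to 1. The generator `v` then spans a free direct summand. -/
theorem exists_linearMap_eq_one {p : ℕ} [Fact p.Prime] [CharP K p]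
    (hG : ∀ a b : G, a * b = b * a) (hp : ∀ g : G, g ^ p = 1) {v : N}
    (hv : normElement K G • v ≠ 0) :
    ∃ φ : N →ₗ[MonoidAlgebra K G] MonoidAlgebra K G, φ v = 1 := by
  obtain ⟨f, hf⟩ : ∃ f : Module.Dual K N, f (normElement K G • v) ≠ 0 := by
    by_contra! h
    exact hv ((Module.forall_dual_apply_eq_zero_iff K _).1 h)
  let act : G → N →ₗ[K] N := fun g =>
    { toFun := fun n => (MonoidAlgebra.single g 1 : MonoidAlgebra K G) • n
      map_add' := fun _ _ => smul_add _ _ _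
      map_smul' := fun c n => smul_algebra_smul_comm c _ n }
  let φ₀ : N →ₗ[K] MonoidAlgebra K G :=
    ∑ g, (LinearMap.toSpanSingleton K _ (MonoidAlgebra.single g (1 : K))) ∘ₗ f ∘ₗ act g⁻¹
  have hφ₀ : ∀ n, φ₀ n = ∑ g, MonoidAlgebra.single g
      (f ((MonoidAlgebra.single g⁻¹ 1 : MonoidAlgebra K G) • n)) := fun n => by
    simp [φ₀, act, LinearMap.sum_apply, MonoidAlgebra.smul_single]
  let φ : N →ₗ[MonoidAlgebra K G] MonoidAlgebra K G :=
    MonoidAlgebra.equivariantOfLinearOfComm φ₀ fun h n => by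
      rw [hφ₀, hφ₀, Finset.smul_sum]
      refine Fintype.sum_equiv (Equiv.mulLeft h⁻¹) _ _ fun g => ?_
      simp [MonoidAlgebra.single_mul_single, ← mul_smul]
  have hu : IsUnit (φ v) := by
    refine isUnit_of_augmentation_ne_zero hG hp ?_
    convert! hf
    change augmentation K G (φ₀ v) = _
    rw [hφ₀, map_sum, normElement, Finset.sum_smul, map_sum]
    refine Fintype.sum_equiv (Equiv.inv G) _ _ fun g => ?_
    rw [augmentation_single]
    rfl
  obtain ⟨u, hu⟩ := hu
  refine ⟨LinearMap.toSpanSingleton _ _ (↑u⁻¹ : MonoidAlgebra K G) ∘ₗ φ, ?_⟩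
  simp [← hu]

theorem smul_eq_zero_of_normElement_smul_ne_zero {p : ℕ} [Fact p.Prime] [CharP K p]
    (hG : ∀ a b : G, a * b = b * a) (hp : ∀ g : G, g ^ p = 1) {v : N}
    (hv : normElement K G • v ≠ 0) {x : MonoidAlgebra K G} (hx : x • v = 0) : x = 0 := by
  obtain ⟨φ, hφ⟩ := exists_linearMap_eq_one hG hp hv
  have := congrArg φ hx
  simpa [hφ] using this

theorem projective_span_singleton {R M : Type*} [Ring R] [AddCommGroup M] [Module R M] {v : M}
    (hv : ∀ x : R, x • v = 0 → x = 0) : Module.Projective R (Submodule.span R {v}) := by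
  have h : LinearMap.ker (LinearMap.toSpanSingleton R M v) = ⊥ :=
    LinearMap.ker_eq_bot'.2 fun x hx => hv x hx
  have e := LinearEquiv.ofInjective _ (LinearMap.ker_eq_bot.1 h)
  rw [LinearMap.range_toSpanSingleton] at e
  exact Module.Projective.of_equiv e

/-- A submodule without nonzero projective summands is annihilated by the norm element. -/
theorem normElement_smul_eq_zero_of_no_projective_summand {p : ℕ} [Fact p.Prime] [CharP K p]
    (hG : ∀ a b : G, a * b = b * a) (hp : ∀ g : G, g ^ p = 1)
    {C : Submodule (MonoidAlgebra K G) N}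
    (hC : ∀ A B : Submodule (MonoidAlgebra K G) N, Disjoint A B → A ⊔ B = C →
      Module.Projective (MonoidAlgebra K G) A → A = ⊥) {c : N} (hc : c ∈ C) :
    normElement K G • c = 0 := by
  by_contra hv
  obtain ⟨φ, hφ⟩ := exists_linearMap_eq_one hG hp hv
  -- Since `φ c = 1`, the decomposition `x = φ(x) c + (x - φ(x) c)` splits `C` into the free module
  -- on `c` and `C ⊓ ker φ`.
  have hbot := hC (Submodule.span _ {c}) (C ⊓ LinearMap.ker φ) ?_ ?_
    (projective_span_singleton fun x => smul_eq_zero_of_normElement_smul_ne_zero hG hp hv)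
  · rw [Submodule.span_singleton_eq_bot] at hbot
    exact hv (by rw [hbot, smul_zero])
  · rw [Submodule.disjoint_def]
    intro x hx hx'
    obtain ⟨r, rfl⟩ := Submodule.mem_span_singleton.1 hx
    have h : φ (r • c) = 0 := hx'.2
    rw [map_smul, hφ, smul_eq_mul, mul_one] at h
    rw [h, zero_smul]
  · refine le_antisymm (sup_le ((Submodule.span_singleton_le_iff_mem _ _).2 hc) inf_le_left) ?_
    intro x hx
    have h : x - φ x • c ∈ C ⊓ LinearMap.ker φ :=
      ⟨sub_mem hx (C.smul_mem _ hc), by simp [hφ]⟩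
    have := add_mem (Submodule.mem_sup_left (Submodule.smul_mem _ (φ x)
      (Submodule.mem_span_singleton_self c))) (Submodule.mem_sup_right h)
    simpa using this

/-- A projective submodule that is annihilated by the norm element is zero. -/
theorem eq_bot_of_projective_of_normElement_smul {p : ℕ} [Fact p.Prime] [CharP K p]
    (hG : ∀ a b : G, a * b = b * a) (hp : ∀ g : G, g ^ p = 1) [Module.Finite K N]
    {A : Submodule (MonoidAlgebra K G) N} [Module.Projective (MonoidAlgebra K G) A]
    (hA : ∀ a ∈ A, normElement K G • a = 0) : A = ⊥ := by
  have := finite_submodule A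
  have : Module.Free (MonoidAlgebra K G) A := free_of_projective hG hp
  let e := Module.Free.chooseBasis (MonoidAlgebra K G) A
  refine (Submodule.eq_bot_iff _).2 fun a ha => ?_
  by_contra hne
  have : Nonempty (Module.Free.ChooseBasisIndex (MonoidAlgebra K G) A) := by
    by_contra h
    rw [not_nonempty_iff] at h
    have := e.repr.toEquiv.subsingleton
    exact hne (congrArg Subtype.val (Subsingleton.elim (⟨a, ha⟩ : A) 0))
  obtain ⟨i⟩ := this
  -- A basis vector has zero annihilator, yet the nonzero norm element would kill this one.
  have h : normElement K G • e i = 0 := Subtype.ext (hA _ (e i).2)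
  have := congrArg (fun x => e.repr x i) h
  simp at this
  exact normElement_ne_zero this

/-- Multiplication by the norm element, as a `K`-linear map. -/
noncomputable def normMap (K G N : Type*) [Field K] [Group G] [Fintype G] [AddCommGroup N]
    [Module K N] [Module (MonoidAlgebra K G) N] [IsScalarTower K (MonoidAlgebra K G) N] :
    N →ₗ[K] N where
  toFun n := normElement K G • n
  map_add' := smul_add _
  map_smul' c n := smul_algebra_smul_comm c _ n

/-- By `normElement_mul`, the norm element maps a free module onto the `K`-span of its multiples of
the basis vectors. So the rank over `K` of the norm map is the `KG`-rank. -/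
theorem card_mul_finrank_normMap_of_free [Module.Finite K N] [Module.Free (MonoidAlgebra K G) N] :
    Fintype.card G * Module.finrank K (LinearMap.range (normMap K G N)) = Module.finrank K N := by
  have : Module.Finite (MonoidAlgebra K G) N := Module.Finite.of_restrictScalars_finite K _ _
  let e := Module.Free.chooseBasis (MonoidAlgebra K G) N
  have hcard : Module.finrank K (MonoidAlgebra K G) = Fintype.card G :=
    Module.finrank_eq_card_basis (MonoidAlgebra.basis G K)
  let eK := (MonoidAlgebra.basis G K).smulTower e
  have h1 : Module.finrank K N =
      Fintype.card G * Fintype.card (Module.Free.ChooseBasisIndex (MonoidAlgebra K G) N) := by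
    rw [Module.finrank_eq_card_basis eK, Fintype.card_prod]
  have hlin : LinearIndependent K fun i => normElement K G • e i := by
    rw [linearIndependent_iff']
    intro s c hc i hi
    have := congrArg (fun x => e.repr x i) hc
    simp only [← smul_assoc, map_sum, map_smul, Module.Basis.repr_self, Finsupp.finsetSum_apply,
      map_zero, Finsupp.zero_apply, Finsupp.smul_apply, Finsupp.single_apply] at this
    simp [hi] at this
    exact this.resolve_right normElement_ne_zero
  have h2 : LinearMap.range (normMap K G N) =
      Submodule.span K (Set.range fun i => normElement K G • e i) := by
    refine le_antisymm ?_ (Submodule.span_le.2 ?_)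
    · rintro _ ⟨n, rfl⟩
      rw [← e.sum_repr n, map_sum]
      refine sum_mem fun i _ => ?_
      change normElement K G • (_ • e i) ∈ _
      rw [← mul_smul, normElement_mul, smul_assoc]
      exact Submodule.smul_mem _ _ (Submodule.subset_span ⟨i, rfl⟩)
    · rintro _ ⟨i, rfl⟩
      exact ⟨e i, rfl⟩
  rw [h1, h2, finrank_span_eq_card hlin]

/-- The dimension of a complement of a projective submodule that is annihilated by the norm
element. -/
theorem finrank_add_card_mul_finrank_normMap {p : ℕ} [Fact p.Prime] [CharP K p]
    (hG : ∀ a b : G, a * b = b * a) (hp : ∀ g : G, g ^ p = 1) [Module.Finite K N]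
    {C Q : Submodule (MonoidAlgebra K G) N} (hCQ : IsCompl C Q)
    [Module.Projective (MonoidAlgebra K G) Q] (hC : ∀ c ∈ C, normElement K G • c = 0) :
    Module.finrank K (C.restrictScalars K) +
      Fintype.card G * Module.finrank K (LinearMap.range (normMap K G N)) =
        Module.finrank K N := by
  have := finite_submodule Q
  have : Module.Free (MonoidAlgebra K G) Q := free_of_projective hG hp
  have : Module.Finite K Q := (inferInstance : Module.Finite K (Q.restrictScalars K))
  have h1 := card_mul_finrank_normMap_of_free (K := K) (G := G) (N := Q)
  -- The summand `C` contributes nothing, so the norm image in `N` is that of the free module `Q`.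
  have h2 : LinearMap.range (normMap K G N) =
      (LinearMap.range (normMap K G Q)).map (Q.restrictScalars K).subtype := by
    refine le_antisymm ?_ ?_
    · rintro _ ⟨n, rfl⟩
      obtain ⟨c, hc, q, hq, rfl⟩ := Submodule.mem_sup.1 (hCQ.sup_eq_top ▸ Submodule.mem_top : n ∈ _)
      refine ⟨normElement K G • ⟨q, hq⟩, ⟨⟨q, hq⟩, rfl⟩, ?_⟩
      change normElement K G • q = normElement K G • (c + q)
      rw [smul_add, hC c hc, zero_add]
    · rintro _ ⟨_, ⟨q, rfl⟩, rfl⟩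
      exact ⟨q, rfl⟩
  have h3 : Module.finrank K (LinearMap.range (normMap K G N)) =
      Module.finrank K (LinearMap.range (normMap K G Q)) := by
    rw [h2]
    exact (Submodule.equivMapOfInjective (Q.restrictScalars K).subtype Subtype.val_injective
      (LinearMap.range (normMap K G Q))).finrank_eq.symm
  have h4 : IsCompl (C.restrictScalars K) (Q.restrictScalars K) := by
    constructor
    · exact Submodule.disjoint_def.2 fun x => Submodule.disjoint_def.1 hCQ.disjoint x
    · rw [codisjoint_iff, eq_top_iff]
      intro n _
      obtain ⟨c, hc, q, hq, rfl⟩ := Submodule.mem_sup.1 (hCQ.sup_eq_top ▸ Submodule.mem_top : n ∈ _)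
      exact add_mem (Submodule.mem_sup_left hc) (Submodule.mem_sup_right hq)
  rw [h3, h1, ← Submodule.finrank_add_eq_of_isCompl h4]
  rfl

/-- Any projective summand of `C` is also killed by the norm element, hence zero. -/
theorem isCore_of_normElement_smul {p : ℕ} [Fact p.Prime] [CharP K p]
    (hG : ∀ a b : G, a * b = b * a) (hp : ∀ g : G, g ^ p = 1) [Module.Finite K N]
    {C Q : Submodule (MonoidAlgebra K G) N} (hCQ : IsCompl C Q)
    (hQ : Module.Projective (MonoidAlgebra K G) Q) (hC : ∀ c ∈ C, normElement K G • c = 0) :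
    IsCore C := by
  refine ⟨⟨Q, hCQ, hQ⟩, fun A B _ hAB hA => ?_⟩
  exact eq_bot_of_projective_of_normElement_smul hG hp fun a ha =>
    hC a (hAB ▸ Submodule.mem_sup_left ha)

/-- All cores of a module have the same dimension. -/
theorem finrank_eq_of_isCore {p : ℕ} [Fact p.Prime] [CharP K p]
    (hG : ∀ a b : G, a * b = b * a) (hp : ∀ g : G, g ^ p = 1) [Module.Finite K N]
    {C C' : Submodule (MonoidAlgebra K G) N} (hC : IsCore C) (hC' : IsCore C') :
    Module.finrank K (C.restrictScalars K) = Module.finrank K (C'.restrictScalars K) := by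
  obtain ⟨⟨Q, hQ, hQp⟩, h⟩ := hC
  obtain ⟨⟨Q', hQ', hQp'⟩, h'⟩ := hC'
  -- Either dimension is that of `N` minus `|G|` times the rank of the norm map on `N`, a quantity
  -- independent of the core.
  have e := finrank_add_card_mul_finrank_normMap hG hp hQ fun c hc =>
    normElement_smul_eq_zero_of_no_projective_summand hG hp h hc
  have e' := finrank_add_card_mul_finrank_normMap hG hp hQ' fun c hc =>
    normElement_smul_eq_zero_of_no_projective_summand hG hp h' hc
  omega

end Norm

end GroupAlgebra

theorem _root_.iSupIndep.projective_iSup {R M ι : Type*} [Ring R] [AddCommGroup M] [Module R M]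
    {A : ι → Submodule R M} (hA : iSupIndep A) (hproj : ∀ i, Module.Projective R (A i)) :
    Module.Projective R (⨆ i, A i : Submodule R M) := by
  classical
  rw [Submodule.iSup_eq_range_dfinsupp_lsum]
  exact Module.Projective.of_equiv (LinearEquiv.ofInjective _ hA.dfinsupp_lsum_injective)

/-! ### Monomial modules -/

section Monomial

variable {K G N X : Type*} [Field K] [Group G] [AddCommGroup N] [Module K N]
  [Module (MonoidAlgebra K G) N] [IsScalarTower K (MonoidAlgebra K G) N]

theorem single_smul_eq (g : G) (a : K) (n : N) :
    (MonoidAlgebra.single g a : MonoidAlgebra K G) • n =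
      a • (MonoidAlgebra.single g 1 : MonoidAlgebra K G) • n := by
  rw [← smul_assoc, MonoidAlgebra.smul_single, smul_eq_mul, mul_one]

theorem finrank_span_basis_image {N : Type*} [AddCommMonoid N] [Module K N] [Finite X]
    (b : Module.Basis X K N) (S : Set X) :
    Module.finrank K (Submodule.span K (b '' S)) = S.ncard := by
  classical
  have := Fintype.ofFinite X
  have h := finrank_span_eq_card (R := K)
    (b.linearIndependent.comp ((↑) : S → X) Subtype.val_injective)
  rw [Set.range_comp, Subtype.range_coe] at h
  rw [h, ← Nat.card_eq_fintype_card]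
  rfl

theorem span_image_univ (b : Module.Basis X K N) :
    Submodule.span (MonoidAlgebra K G) (b '' Set.univ) = ⊤ := by
  refine eq_top_iff.2 fun n _ => ?_
  have h : n ∈ Submodule.span K (Set.range b) := b.span_eq ▸ Submodule.mem_top
  rw [Set.image_univ]
  exact Submodule.span_le_restrictScalars K (MonoidAlgebra K G) _ h

variable [MulAction G X]

/-- The group permutes the elements of the basis up to scalars. -/
def IsMonomial (b : Module.Basis X K N) : Prop :=
  ∀ (g : G) (x : X), ∃ u : K,
    (MonoidAlgebra.single g 1 : MonoidAlgebra K G) • b x = u • b (g • x)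

variable {b : Module.Basis X K N}

theorem IsMonomial.exists_ne_zero (hb : IsMonomial (G := G) b) (g : G) (x : X) :
    ∃ u : K, u ≠ 0 ∧ (MonoidAlgebra.single g 1 : MonoidAlgebra K G) • b x = u • b (g • x) := by
  obtain ⟨u, hu⟩ := hb g x
  refine ⟨u, ?_, hu⟩
  rintro rfl
  rw [zero_smul] at hu
  have := congrArg (fun n => (MonoidAlgebra.single g⁻¹ 1 : MonoidAlgebra K G) • n) hu
  simp only [← mul_smul, MonoidAlgebra.single_mul_single, smul_zero, inv_mul_cancel, mul_one,
    ← MonoidAlgebra.one_def, one_smul] at this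
  exact b.ne_zero x this

/-- The scalar `u` satisfies `u ^ p = 1`, so `(u - 1) ^ p = 0` and `u = 1`. This is why the signs of
the action do not matter on stabilizers. -/
theorem IsMonomial.single_smul_of_fixed {p : ℕ} [Fact p.Prime] [CharP K p]
    (hb : IsMonomial (G := G) b) {g : G} (hg : g ^ p = 1) {x : X} (hx : g • x = x) :
    (MonoidAlgebra.single g 1 : MonoidAlgebra K G) • b x = b x := by
  obtain ⟨u, hu⟩ := hb g x
  rw [hx] at hu
  have hpow : ∀ m : ℕ,
      (MonoidAlgebra.single g 1 : MonoidAlgebra K G) ^ m • b x = u ^ m • b x := by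
    intro m
    induction m with
    | zero => simp
    | succ m ih => rw [pow_succ, mul_smul, hu, smul_algebra_smul_comm, ih, smul_smul, pow_succ']
  have h := hpow p
  rw [MonoidAlgebra.single_pow, hg, one_pow, ← MonoidAlgebra.one_def, one_smul] at h
  have h1 : u ^ p = 1 := by
    have := congrArg (fun n => b.repr n x) h
    simpa using this.symm
  have h2 : u = 1 := by
    have : (u - 1) ^ p = 0 := by rw [sub_pow_char, h1, one_pow, sub_self]
    exact sub_eq_zero.1 (pow_eq_zero_iff (Fact.out : p.Prime).ne_zero |>.1 this)
  rw [hu, h2, one_smul]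

theorem IsMonomial.restrictScalars_span (hb : IsMonomial (G := G) b) {S : Set X}
    (hS : ∀ (g : G), ∀ x ∈ S, g • x ∈ S) :
    (Submodule.span (MonoidAlgebra K G) (b '' S)).restrictScalars K =
      Submodule.span K (b '' S) := by
  have hsingle : ∀ (g : G), ∀ n ∈ Submodule.span K (b '' S),
      (MonoidAlgebra.single g 1 : MonoidAlgebra K G) • n ∈ Submodule.span K (b '' S) := by
    intro g n hn
    induction hn using Submodule.span_induction with
    | mem n hn =>
      obtain ⟨x, hx, rfl⟩ := hn
      obtain ⟨u, hu⟩ := hb g x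
      rw [hu]
      exact Submodule.smul_mem _ _ (Submodule.subset_span ⟨_, hS g x hx, rfl⟩)
    | zero =>
      rw [smul_zero]
      exact zero_mem _
    | add x y _ _ hx hy =>
      rw [smul_add]
      exact add_mem hx hy
    | smul c n _ hn =>
      rw [smul_algebra_smul_comm]
      exact Submodule.smul_mem _ _ hn
  have hmem : ∀ n ∈ Submodule.span (MonoidAlgebra K G) (b '' S),
      n ∈ Submodule.span K (b '' S) := by
    intro n hn
    induction hn using Submodule.span_induction with
    | mem n hn => exact Submodule.subset_span hn
    | zero => exact zero_mem _
    | add x y _ _ hx hy => exact add_mem hx hy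
    | smul r n _ hn =>
      refine MonoidAlgebra.induction_linear r ?_ (fun r s hr hs => ?_) (fun g a => ?_)
      · rw [zero_smul]
        exact zero_mem _
      · rw [add_smul]
        exact add_mem hr hs
      · rw [single_smul_eq]
        exact Submodule.smul_mem _ _ (hsingle g n hn)
  exact le_antisymm hmem (Submodule.span_le_restrictScalars _ _ _)

theorem IsMonomial.mem_span_singleton (hb : IsMonomial (G := G) b) (g : G) (x : X) :
    b (g • x) ∈ Submodule.span (MonoidAlgebra K G) {b x} := by
  obtain ⟨u, hu0, hu⟩ := hb.exists_ne_zero g x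
  refine Submodule.mem_span_singleton.2 ⟨MonoidAlgebra.single g u⁻¹, ?_⟩
  rw [single_smul_eq, hu, inv_smul_smul₀ hu0]

theorem IsMonomial.span_singleton_eq (hb : IsMonomial (G := G) b) (x : X) :
    Submodule.span (MonoidAlgebra K G) {b x} =
      Submodule.span (MonoidAlgebra K G) (b '' MulAction.orbit G x) := by
  refine le_antisymm (Submodule.span_mono ?_) (Submodule.span_le.2 ?_)
  · rintro _ rfl
    exact ⟨x, MulAction.mem_orbit_self x, rfl⟩
  · rintro _ ⟨_, ⟨g, rfl⟩, rfl⟩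
    exact hb.mem_span_singleton g x

theorem IsMonomial.restrictScalars_span_singleton (hb : IsMonomial (G := G) b) (x : X) :
    (Submodule.span (MonoidAlgebra K G) {b x}).restrictScalars K =
      Submodule.span K (b '' MulAction.orbit G x) := by
  rw [hb.span_singleton_eq, hb.restrictScalars_span]
  rintro g _ ⟨h, rfl⟩
  exact ⟨g * h, mul_smul g h x⟩

variable {t : MulAction.orbitRel.Quotient G X → X}

theorem mk_eq_iff_mem_orbit (ht : ∀ α, (Quotient.mk _ (t α) : MulAction.orbitRel.Quotient G X) = α)
    {x : X} {α : MulAction.orbitRel.Quotient G X} :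
    (Quotient.mk _ x : MulAction.orbitRel.Quotient G X) = α ↔ x ∈ MulAction.orbit G (t α) := by
  rw [← MulAction.orbitRel_apply]
  conv_lhs => rw [← ht α]
  exact Quotient.eq

theorem mk_smul_eq (g : G) (x : X) :
    (Quotient.mk _ (g • x) : MulAction.orbitRel.Quotient G X) = Quotient.mk _ x :=
  Quotient.sound (MulAction.orbitRel_apply.2 ⟨g, rfl⟩)

theorem IsMonomial.iSup_span_singleton (hb : IsMonomial (G := G) b)
    (ht : ∀ α, (Quotient.mk _ (t α) : MulAction.orbitRel.Quotient G X) = α)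
    (S : Set (MulAction.orbitRel.Quotient G X)) :
    ⨆ α ∈ S, Submodule.span (MonoidAlgebra K G) {b (t α)} =
      Submodule.span (MonoidAlgebra K G)
        (b '' {x | (Quotient.mk _ x : MulAction.orbitRel.Quotient G X) ∈ S}) := by
  refine le_antisymm (iSup₂_le fun α hα => Submodule.span_mono ?_) (Submodule.span_le.2 ?_)
  · rintro _ rfl
    exact ⟨t α, by rwa [Set.mem_ofPred_eq, ht], rfl⟩
  · rintro _ ⟨x, hx, rfl⟩
    obtain ⟨g, hg⟩ := (mk_eq_iff_mem_orbit ht (x := x)).1 rfl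
    refine Submodule.mem_iSup_of_mem _ (Submodule.mem_iSup_of_mem hx ?_)
    have := hb.mem_span_singleton g (t (Quotient.mk _ x))
    rwa [show g • t (Quotient.mk _ x) = x from hg] at this

theorem IsMonomial.disjoint_span (hb : IsMonomial (G := G) b)
    {S T : Set (MulAction.orbitRel.Quotient G X)} (hST : Disjoint S T) :
    Disjoint
      (Submodule.span (MonoidAlgebra K G)
        (b '' {x | (Quotient.mk _ x : MulAction.orbitRel.Quotient G X) ∈ S}))
      (Submodule.span (MonoidAlgebra K G)
        (b '' {x | (Quotient.mk _ x : MulAction.orbitRel.Quotient G X) ∈ T})) := by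
  have hinv : ∀ (S : Set (MulAction.orbitRel.Quotient G X)) (g : G),
      ∀ x ∈ {x | (Quotient.mk _ x : MulAction.orbitRel.Quotient G X) ∈ S},
        g • x ∈ {x | (Quotient.mk _ x : MulAction.orbitRel.Quotient G X) ∈ S} := by
    intro S g x hx
    rwa [Set.mem_ofPred_eq, mk_smul_eq]
  have hd : Disjoint {x | (Quotient.mk _ x : MulAction.orbitRel.Quotient G X) ∈ S}
      {x | (Quotient.mk _ x : MulAction.orbitRel.Quotient G X) ∈ T} :=
    Set.disjoint_left.2 fun x hx hx' => Set.disjoint_left.1 hST hx hx'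
  have h := b.linearIndependent.disjoint_span_image hd
  rw [← hb.restrictScalars_span (hinv S), ← hb.restrictScalars_span (hinv T)] at h
  exact Submodule.disjoint_def.2 fun x => Submodule.disjoint_def.1 h x

theorem IsMonomial.iSupIndep (hb : IsMonomial (G := G) b)
    (ht : ∀ α, (Quotient.mk _ (t α) : MulAction.orbitRel.Quotient G X) = α) :
    iSupIndep fun α => Submodule.span (MonoidAlgebra K G) {b (t α)} := by
  intro α
  have h1 := hb.iSup_span_singleton ht {α}
  have h2 := hb.iSup_span_singleton ht {α}ᶜ
  rw [iSup_singleton] at h1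
  change Disjoint (Submodule.span (MonoidAlgebra K G) {b (t α)})
    (⨆ β ∈ ({α}ᶜ : Set _), Submodule.span (MonoidAlgebra K G) {b (t β)})
  rw [h1, h2]
  exact hb.disjoint_span disjoint_compl_right

theorem IsMonomial.iSup_eq_top (hb : IsMonomial (G := G) b)
    (ht : ∀ α, (Quotient.mk _ (t α) : MulAction.orbitRel.Quotient G X) = α) :
    ⨆ α, Submodule.span (MonoidAlgebra K G) {b (t α)} = ⊤ := by
  rw [← iSup_univ, hb.iSup_span_singleton ht]
  exact span_image_univ b

/-- The translates of `b x` are nonzero multiples of distinct basis vectors, so `b x` has zero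
annihilator. -/
theorem IsMonomial.projective_of_free (hb : IsMonomial (G := G) b) {x : X}
    (hx : ∀ g : G, g • x = x → g = 1) :
    Module.Projective (MonoidAlgebra K G) (Submodule.span (MonoidAlgebra K G) {b x}) := by
  refine projective_span_singleton fun r hr => ?_
  choose u hu0 hu using fun g => hb.exists_ne_zero g x
  have hinj : Function.Injective fun g : G => g • x := fun g h hgh => by
    have : (h⁻¹ * g) • x = x := by
      rw [mul_smul, inv_smul_eq_iff]
      exact hgh
    exact (inv_mul_eq_one.1 (hx _ this)).symm
  have hlin := b.linearIndependent.comp _ hinj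
  rw [← MonoidAlgebra.sum_coeff_single r, Finsupp.sum, Finset.sum_smul] at hr
  simp only [single_smul_eq _ (r.coeff _), hu, smul_smul] at hr
  have h := linearIndependent_iff'.1 hlin _ _ hr
  refine MonoidAlgebra.coeff_injective (Finsupp.ext fun g => ?_)
  by_cases hg : g ∈ r.coeff.support
  · exact (mul_eq_zero.1 (h g hg)).resolve_right (hu0 g)
  · simpa using hg

variable [Fintype G]

/-- The element `h - 1` kills `b x`. If the norm element did not, `b x` would have zero annihilator,
forcing `h = 1`. -/
theorem IsMonomial.normElement_smul {p : ℕ} [Fact p.Prime] [CharP K p]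
    (hG : ∀ a b : G, a * b = b * a) (hp : ∀ g : G, g ^ p = 1) (hb : IsMonomial (G := G) b)
    {x : X} {h : G} (hne : h ≠ 1) (hx : h • x = x) : normElement K G • b x = 0 := by
  by_contra hv
  have h0 : (MonoidAlgebra.single h 1 - 1 : MonoidAlgebra K G) • b x = 0 := by
    rw [sub_smul, one_smul, hb.single_smul_of_fixed (hp h) hx, sub_self]
  have := sub_eq_zero.1 (smul_eq_zero_of_normElement_smul_ne_zero hG hp hv h0)
  rw [MonoidAlgebra.one_def, MonoidAlgebra.single_left_inj one_ne_zero] at this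
  exact hne this

theorem IsMonomial.normElement_smul_of_mem_span {p : ℕ} [Fact p.Prime] [CharP K p]
    (hG : ∀ a b : G, a * b = b * a) (hp : ∀ g : G, g ^ p = 1) (hb : IsMonomial (G := G) b)
    {S : Set X} (hS : ∀ x ∈ S, ∃ h : G, h ≠ 1 ∧ h • x = x) {n : N}
    (hn : n ∈ Submodule.span (MonoidAlgebra K G) (b '' S)) : normElement K G • n = 0 := by
  induction hn using Submodule.span_induction with
  | mem n hn =>
    obtain ⟨x, hx, rfl⟩ := hn
    obtain ⟨h, hne, hx⟩ := hS x hx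
    exact hb.normElement_smul hG hp hne hx
  | zero => exact smul_zero _
  | add x y _ _ hx hy => rw [smul_add, hx, hy, add_zero]
  | smul r n _ hn => rw [← mul_smul, normElement_mul, smul_assoc, hn, smul_zero]

/-- The span of an orbit is projective if and only if the action on the orbit is free. -/
theorem IsMonomial.projective_iff {p : ℕ} [Fact p.Prime] [CharP K p]
    (hG : ∀ a b : G, a * b = b * a) (hp : ∀ g : G, g ^ p = 1) [Module.Finite K N]
    (hb : IsMonomial (G := G) b) (x : X) :
    Module.Projective (MonoidAlgebra K G) (Submodule.span (MonoidAlgebra K G) {b x}) ↔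
      ∀ g : G, g • x = x → g = 1 := by
  refine ⟨fun hproj g hg => ?_, hb.projective_of_free⟩
  by_contra hne
  have h := eq_bot_of_projective_of_normElement_smul hG hp
    (A := Submodule.span (MonoidAlgebra K G) {b x}) fun a ha => by
      rw [← Set.image_singleton] at ha
      refine hb.normElement_smul_of_mem_span hG hp ?_ ha
      rintro _ rfl
      exact ⟨g, hne, hg⟩
  rw [Submodule.span_singleton_eq_bot] at h
  exact b.ne_zero x h

/-- The basis elements with nontrivial stabilizer span a core. -/
theorem IsMonomial.isCore {p : ℕ} [Fact p.Prime] [CharP K p]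
    (hG : ∀ a b : G, a * b = b * a) (hp : ∀ g : G, g ^ p = 1) [Module.Finite K N]
    (hb : IsMonomial (G := G) b) :
    IsCore (Submodule.span (MonoidAlgebra K G) (b '' {x | ∃ h : G, h ≠ 1 ∧ h • x = x})) := by
  let t : MulAction.orbitRel.Quotient G X → X := Quotient.out
  have ht : ∀ α, (Quotient.mk _ (t α) : MulAction.orbitRel.Quotient G X) = α := Quotient.out_eq
  let S : Set (MulAction.orbitRel.Quotient G X) := {α | ∃ h : G, h ≠ 1 ∧ h • t α = t α}
  -- Stabilizers are constant along orbits of a commutative group, so this set is a union of orbits.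
  have hS : {x | ∃ h : G, h ≠ 1 ∧ h • x = x} =
      {x | (Quotient.mk _ x : MulAction.orbitRel.Quotient G X) ∈ S} := by
    ext x
    obtain ⟨g, hg⟩ := (mk_eq_iff_mem_orbit ht (x := x)).1 rfl
    simp only [Set.mem_ofPred_eq, S]
    refine exists_congr fun h => and_congr_right fun _ => ?_
    generalize t (Quotient.mk _ x) = y at hg
    subst hg
    change h • g • y = g • y ↔ _
    rw [← mul_smul, hG, mul_smul, smul_left_cancel_iff]
  rw [hS]
  have hcompl : IsCompl
      (Submodule.span (MonoidAlgebra K G)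
        (b '' {x | (Quotient.mk _ x : MulAction.orbitRel.Quotient G X) ∈ S}))
      (Submodule.span (MonoidAlgebra K G)
        (b '' {x | (Quotient.mk _ x : MulAction.orbitRel.Quotient G X) ∈ Sᶜ})) := by
    refine ⟨hb.disjoint_span disjoint_compl_right, codisjoint_iff.2 ?_⟩
    rw [← Submodule.span_union, ← Set.image_union, ← span_image_univ (G := G) b]
    congr 2
    exact Set.eq_univ_of_forall fun x => em _
  refine isCore_of_normElement_smul hG hp hcompl ?_ fun c hc => ?_
  · rw [← hb.iSup_span_singleton ht, ← iSup_subtype'']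
    refine ((hb.iSupIndep ht).comp Subtype.val_injective).projective_iSup fun α => ?_
    refine hb.projective_of_free fun g hg => ?_
    by_contra hne
    exact α.2 ⟨g, hne, hg⟩
  · refine hb.normElement_smul_of_mem_span hG hp (fun x hx => ?_) hc
    rw [← hS] at hx
    exact hx

/-- The sum of the nonprojective spans of orbits is a core. -/
theorem IsMonomial.isCore_iSup {p : ℕ} [Fact p.Prime] [CharP K p]
    (hG : ∀ a b : G, a * b = b * a) (hp : ∀ g : G, g ^ p = 1) [Module.Finite K N]
    (hb : IsMonomial (G := G) b)
    (ht : ∀ α, (Quotient.mk _ (t α) : MulAction.orbitRel.Quotient G X) = α) :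
    IsCore (⨆ α ∈ {α | ¬ Module.Projective (MonoidAlgebra K G)
      (Submodule.span (MonoidAlgebra K G) {b (t α)})},
        Submodule.span (MonoidAlgebra K G) {b (t α)}) := by
  rw [hb.iSup_span_singleton ht]
  convert! hb.isCore hG hp using 3
  ext x
  have hspan : Submodule.span (MonoidAlgebra K G) {b (t (Quotient.mk _ x))} =
      Submodule.span (MonoidAlgebra K G) {b x} := by
    have horb := MulAction.orbit_eq_iff.2 ((mk_eq_iff_mem_orbit ht (x := x)).1 rfl)
    rw [hb.span_singleton_eq, hb.span_singleton_eq, ← horb]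
  rw [Set.mem_ofPred_eq, Set.mem_ofPred_eq, Set.mem_ofPred_eq, hspan, hb.projective_iff hG hp]
  push Not
  exact exists_congr fun _ => and_comm

/-- The dimension of a core of a monomial module is the number of basis elements with nontrivial
stabilizer. -/
theorem IsMonomial.finrank_of_isCore {p : ℕ} [Fact p.Prime] [CharP K p]
    (hG : ∀ a b : G, a * b = b * a) (hp : ∀ g : G, g ^ p = 1) [Module.Finite K N] [Finite X]
    (hb : IsMonomial (G := G) b) {C : Submodule (MonoidAlgebra K G) N} (hC : IsCore C) :
    Module.finrank K (C.restrictScalars K) = {x : X | ∃ h : G, h ≠ 1 ∧ h • x = x}.ncard := by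
  rw [finrank_eq_of_isCore hG hp hC (hb.isCore hG hp), hb.restrictScalars_span,
    finrank_span_basis_image]
  rintro g x ⟨h, hne, hx⟩
  exact ⟨h, hne, by rw [← mul_smul, hG, mul_smul, hx]⟩

end Monomial

/-! ### The Benson-Symonds invariant of a monomial representation -/

section Representation

variable {K G V X : Type*} [Field K] [Group G] [AddCommGroup V] [Module K V]

/-- The basis of the module of a representation that is given by a basis of the representation
space. -/
noncomputable def asModuleBasis (ρ : Representation K G V) (b : Module.Basis X K V) :
    Module.Basis X K ρ.asModule :=
  b.map ρ.asModuleEquiv.symm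

theorem asModuleBasis_apply (ρ : Representation K G V) (b : Module.Basis X K V) (x : X) :
    asModuleBasis ρ b x = ρ.asModuleEquiv.symm (b x) := rfl

variable [MulAction G X]

theorem isMonomial_asModuleBasis {ρ : Representation K G V} {b : Module.Basis X K V}
    (hb : ∀ (g : G) (x : X), ∃ u : K, ρ g (b x) = u • b (g • x)) :
    IsMonomial (G := G) (asModuleBasis ρ b) := by
  intro g x
  obtain ⟨u, hu⟩ := hb g x
  refine ⟨u, ?_⟩
  refine (ρ.asModuleEquiv_symm_map_rho g (b x)).symm.trans ?_
  rw [hu, map_smul]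
  rfl

/-- The scalar for a tuple is the product of the scalars of its entries, so tensor powers of
monomial representations are monomial on tuples. -/
theorem tensorPower_basis {ρ : Representation K G V} {b : Module.Basis X K V}
    (hb : ∀ (g : G) (x : X), ∃ u : K, ρ g (b x) = u • b (g • x)) (n : ℕ) (g : G)
    (f : Fin n → X) : ∃ u : K,
      tensorPower ρ n g (Basis.piTensorProduct (fun _ => b) f) =
        u • Basis.piTensorProduct (fun _ : Fin n => b) (g • f) := by
  choose u hu using fun i => hb g (f i)
  refine ⟨∏ i, u i, ?_⟩
  rw [Basis.piTensorProduct_apply, Basis.piTensorProduct_apply]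
  change PiTensorProduct.map (fun _ => ρ g) _ = _
  rw [PiTensorProduct.map_tprod]
  simp only [hu, Pi.smul_apply]
  exact MultilinearMap.map_smul_univ _ _ _

/-- A squeeze, since the `n`-th root of the positive constant `k` tends to 1. -/
theorem tendsto_rpow_of_pow_le_of_le_mul_pow {c : ℕ → ℕ} {a k : ℕ} (hk : 1 ≤ k)
    (h1 : ∀ n, a ^ n ≤ c n) (h2 : ∀ n, c n ≤ k * a ^ n) :
    Tendsto (fun n : ℕ => (c n : ℝ) ^ (1 / (n : ℝ))) atTop (𝓝 (a : ℝ)) := by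
  have hroot : ∀ n : ℕ, n ≠ 0 → ((a : ℝ) ^ n) ^ (1 / (n : ℝ)) = a := fun n hn => by
    rw [one_div, Real.pow_rpow_inv_natCast (Nat.cast_nonneg a) hn]
  have hlim : Tendsto (fun n : ℕ => (k : ℝ) ^ (1 / (n : ℝ)) * a) atTop (𝓝 (a : ℝ)) := by
    have hk0 : (k : ℝ) ≠ 0 := Nat.cast_ne_zero.2 (by omega)
    have h := (tendsto_const_nhds (x := (k : ℝ))).rpow tendsto_one_div_atTop_nhds_zero_nat
      (Or.inl hk0)
    simpa using h.mul_const (a : ℝ)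
  refine tendsto_of_tendsto_of_tendsto_of_le_of_le' tendsto_const_nhds hlim ?_ ?_
  · filter_upwards [eventually_ne_atTop 0] with n hn
    calc (a : ℝ) = ((a : ℝ) ^ n) ^ (1 / (n : ℝ)) := (hroot n hn).symm
      _ ≤ _ := Real.rpow_le_rpow (by positivity) (by exact_mod_cast h1 n) (by positivity)
  · filter_upwards [eventually_ne_atTop 0] with n hn
    calc (c n : ℝ) ^ (1 / (n : ℝ)) ≤ ((k : ℝ) * (a : ℝ) ^ n) ^ (1 / (n : ℝ)) :=
          Real.rpow_le_rpow (by positivity) (by exact_mod_cast h2 n) (by positivity)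
      _ = _ := by rw [Real.mul_rpow (by positivity) (by positivity), hroot n hn]

theorem ncard_fixed_tuples [Finite X] (g : G) (n : ℕ) :
    {f : Fin n → X | g • f = f}.ncard = {x : X | g • x = x}.ncard ^ n := by
  rw [← Nat.card_coe_set_eq, ← Nat.card_coe_set_eq]
  have e : {f : Fin n → X | g • f = f} ≃ (Fin n → {x : X | g • x = x}) :=
    { toFun := fun f i => ⟨f.1 i, congrFun f.2 i⟩
      invFun := fun f => ⟨fun i => (f i).1, funext fun i => (f i).2⟩
      left_inv := fun _ => rfl
      right_inv := fun _ => rfl }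
  rw [Nat.card_congr e, Nat.card_fun, Nat.card_fin]

/-- The Benson-Symonds invariant of a monomial representation of a commutative group of exponent
`p`, if every tuple of basis elements with nontrivial stabilizer is fixed by one of the `τ j`, and
all `τ j` have the same number of fixed points. -/
theorem hasBensonSymondsInvariant_of_monomial {p : ℕ} [Fact p.Prime] [CharP K p]
    (hG : ∀ a b : G, a * b = b * a) (hp : ∀ g : G, g ^ p = 1) [Finite G] [Finite X]
    {ρ : Representation K G V} {b : Module.Basis X K V}
    (hb : ∀ (g : G) (x : X), ∃ u : K, ρ g (b x) = u • b (g • x))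
    {k a : ℕ} (hk : 1 ≤ k) (τ : Fin k → G) (hτ : ∀ j, τ j ≠ 1)
    (hfix : ∀ (n : ℕ) (f : Fin n → X), (∃ h : G, h ≠ 1 ∧ h • f = f) → ∃ j, τ j • f = f)
    (hcard : ∀ j, {x : X | τ j • x = x}.ncard = a) :
    HasBensonSymondsInvariant ρ a := by
  classical
  have := Fintype.ofFinite G
  have := Module.Finite.of_basis b
  have hb' := fun n => isMonomial_asModuleBasis (tensorPower_basis hb n)
  have hfin : ∀ n, Module.Finite K (tensorPower ρ n).asModule := fun n =>
    Module.Finite.of_basis (asModuleBasis _ (Basis.piTensorProduct fun _ : Fin n => b))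
  refine ⟨fun n => ⟨_, (hb' n).isCore hG hp⟩, fun C hC => ?_⟩
  have hdim : ∀ n, dimension (C n) = {f : Fin n → X | ∃ h : G, h ≠ 1 ∧ h • f = f}.ncard :=
    fun n => (hb' n).finrank_of_isCore hG hp (hC n)
  have hset : ∀ n, {f : Fin n → X | ∃ h : G, h ≠ 1 ∧ h • f = f} =
      ⋃ j, {f : Fin n → X | τ j • f = f} := fun n => by
    ext f
    rw [Set.mem_iUnion]
    exact ⟨hfix n f, fun ⟨j, hj⟩ => ⟨τ j, hτ j, hj⟩⟩
  -- The lower bound keeps the fixed tuples of a single `τ j`; the upper bound is the union bound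
  -- over the `k` fixed sets.
  refine tendsto_rpow_of_pow_le_of_le_mul_pow hk (fun n => ?_) (fun n => ?_)
  · rw [hdim, hset, ← hcard ⟨0, hk⟩, ← ncard_fixed_tuples]
    exact Set.ncard_le_ncard (Set.subset_iUnion (fun j => {f : Fin n → X | τ j • f = f}) _)
      (Set.toFinite _)
  · rw [hdim, hset]
    refine (Set.ncard_iUnion_le_of_fintype _).trans ?_
    simp only [ncard_fixed_tuples, hcard]
    simp

end Representation

/-! ### Orbits of commutative groups generated by elements of order `p` -/

/-- As `m` is invertible modulo `p`, `g` is a power of `g ^ m`. -/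
theorem smul_eq_of_zpow_smul_eq {G X : Type*} [Group G] [MulAction G X] {p : ℕ} [Fact p.Prime]
    {g : G} (hg : g ^ p = 1) {x : X} {m : ℤ} (hm : ¬ (p : ℤ) ∣ m) (hx : g ^ m • x = x) :
    g • x = x := by
  have hcop : IsCoprime (p : ℤ) m :=
    (Prime.coprime_iff_not_dvd (Nat.prime_iff_prime_int.1 Fact.out)).2 hm
  obtain ⟨u, v, huv⟩ := hcop
  have h1 : g = (g ^ m) ^ v := by
    conv_lhs => rw [← zpow_one g, ← huv, zpow_add, mul_comm u, zpow_mul, zpow_natCast, hg,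
      one_zpow, one_mul, mul_comm v, zpow_mul]
  rw [h1]
  exact MulAction.mem_stabilizer_iff.1
    (zpow_mem (MulAction.mem_stabilizer_iff.2 hx : g ^ m ∈ MulAction.stabilizer G x) v)

/-- By `hx`, a product of powers of the generators fixes `x` only if each factor does. So the
exponents modulo `p` at the generators that move `x` parametrize the orbit. -/
theorem card_orbit_of_generators {G X ι : Type*} [Group G] (hG : ∀ a b : G, a * b = b * a)
    [MulAction G X] [Fintype ι] [DecidableEq ι] {p : ℕ} [Fact p.Prime] (τ : ι → G)
    (hgen : Subgroup.closure (Set.range τ) = ⊤) (hτ : ∀ i, τ i ^ p = 1) {x : X}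
    (hx : ∀ (i : ι) (m : ℤ), ∀ h ∈ Subgroup.closure (τ '' {i}ᶜ),
      (τ i ^ m * h) • x = x → τ i ^ m • x = x)
    (I : Finset ι) (hI : ∀ i, i ∈ I ↔ τ i • x ≠ x) :
    Nat.card (MulAction.orbit G x) = p ^ I.card := by
  let : CommGroup G := { (inferInstance : Group G) with mul_comm := hG }
  have hprod : ∀ a : ι → ℤ, (∏ i, τ i ^ a i) • x = x ↔ ∀ i, τ i ^ a i • x = x := by
    intro a
    refine ⟨fun h i => hx i (a i) (∏ j ∈ {i}ᶜ, τ j ^ a j) ?_ ?_, fun h => ?_⟩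
    · refine Subgroup.prod_mem _ fun j hj => Subgroup.zpow_mem _ (Subgroup.subset_closure ?_) _
      exact ⟨j, by simpa using hj, rfl⟩
    · rw [Fintype.prod_eq_mul_prod_compl i] at h
      exact h
    · exact MulAction.mem_stabilizer_iff.1
        (Subgroup.prod_mem _ fun i _ => MulAction.mem_stabilizer_iff.2 (h i))
  have hdiv : ∀ a c : ι → ℤ, (∏ i, τ i ^ a i) • x = (∏ i, τ i ^ c i) • x ↔
      ∀ i, τ i ^ (a i - c i) • x = x := by
    intro a c
    rw [← hprod]
    simp only [zpow_sub, Finset.prod_mul_distrib, Finset.prod_inv_distrib]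
    rw [mul_comm, mul_smul, inv_smul_eq_iff]
  -- Outside `I` the generator fixes `x`, so exponent 0 loses nothing.
  let E : (I → Fin p) → ι → ℤ := fun e i => if h : i ∈ I then (e ⟨i, h⟩ : ℕ) else 0
  let φ : (I → Fin p) → MulAction.orbit G x := fun e => ⟨(∏ i, τ i ^ E e i) • x, _, rfl⟩
  have hp : 0 < p := (Fact.out : p.Prime).pos
  have hφ : Function.Bijective φ := by
    constructor
    · intro e e' hee
      have h := (hdiv _ _).1 (congrArg Subtype.val hee)
      funext i
      have hi := h i
      by_contra hne
      refine (hI i).1 i.2 (smul_eq_of_zpow_smul_eq (hτ i) (fun hd => hne ?_) hi)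
      simp only [E, i.2, dif_pos] at hd
      have h1 := (e i).isLt
      have h2 := (e' i).isLt
      obtain ⟨c, hc⟩ := hd
      -- Two exponents in `[0, p)` differ by less than `p` in absolute value.
      have hc0 : c = 0 := by
        by_contra hc0
        rcases lt_or_gt_of_ne hc0 with hlt | hgt
        · nlinarith
        · nlinarith
      subst hc0
      ext
      simp only [Subtype.coe_eta] at hc
      omega
    · rintro ⟨_, g, rfl⟩
      obtain ⟨a, rfl⟩ := Subgroup.exists_of_mem_closure_range τ g (hgen ▸ Subgroup.mem_top g)
      refine ⟨fun i => ⟨(a i % p).toNat, ?_⟩, Subtype.ext ((hdiv _ _).2 fun i => ?_)⟩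
      · have := Int.emod_lt_of_pos (a i) (by exact_mod_cast hp : (0 : ℤ) < p)
        have := Int.emod_nonneg (a i) (by exact_mod_cast hp.ne' : (p : ℤ) ≠ 0)
        omega
      · by_cases hi : i ∈ I
        · have := Int.emod_nonneg (a i) (by exact_mod_cast hp.ne' : (p : ℤ) ≠ 0)
          simp only [E, hi, dif_pos, Int.toNat_of_nonneg this]
          rw [show a i % p - a i = p * (-(a i / p)) by have := Int.emod_add_mul_ediv (a i) p; linarith,
            zpow_mul, zpow_natCast, hτ, one_zpow, one_smul]
        · have hfix : τ i • x = x := by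
            by_contra h
            exact hi ((hI i).2 h)
          exact MulAction.mem_stabilizer_iff.1
            (zpow_mem (MulAction.mem_stabilizer_iff.2 hfix) _)
  rw [← Nat.card_congr (Equiv.ofBijective φ hφ), Nat.card_fun, Nat.card_fin, Nat.card_eq_fintype_card,
    Fintype.card_coe]

/-! ### The cycles `τ_i` -/

section Cycles

variable {p k a₀ : ℕ}

theorem blockEntry_inj [NeZero p] {i i' : Fin k} {j j' : Fin p}
    (h : blockEntry p k a₀ i j = blockEntry p k a₀ i' j') : i = i' ∧ j = j' := by
  have h1 : (i : ℕ) * p + j = i' * p + j' := congrArg Fin.val h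
  have hp : 0 < p := Nat.pos_of_ne_zero (NeZero.ne p)
  have hi : (i : ℕ) = i' := by
    have := congrArg (· / p) h1
    simpa [Nat.add_div_of_dvd_right, Nat.mul_div_cancel _ hp, Nat.div_eq_of_lt j.isLt,
      Nat.div_eq_of_lt j'.isLt] using this
  refine ⟨Fin.ext hi, Fin.ext ?_⟩
  rw [hi] at h1
  omega

/-- The cycle `τ_i` as an element of the group that they generate. -/
def tauMem (p k a₀ : ℕ) (i : Fin k) : cycleGroup p k a₀ :=
  ⟨tau p k a₀ i, Subgroup.subset_closure ⟨i, rfl⟩⟩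

theorem closure_range_tauMem : Subgroup.closure (Set.range (tauMem p k a₀)) = ⊤ := by
  refine (Subgroup.eq_top_iff' _).2 fun ⟨x, hx⟩ => ?_
  have h := Subgroup.closure_closure_coe_preimage (k := Set.range (tau p k a₀))
  have hr : Set.range (tauMem p k a₀) =
      ((↑) : Subgroup.closure (Set.range (tau p k a₀)) → _) ⁻¹' Set.range (tau p k a₀) := by
    ext y
    constructor
    · rintro ⟨i, rfl⟩
      exact ⟨i, rfl⟩
    · rintro ⟨i, hi⟩
      exact ⟨i, Subtype.ext hi⟩
  rw [hr]
  exact h ▸ Subgroup.mem_top _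

variable [Fact p.Prime]

theorem nodup_block (i : Fin k) : (List.ofFn (blockEntry p k a₀ i)).Nodup :=
  have : NeZero p := ⟨(Fact.out : p.Prime).ne_zero⟩
  List.nodup_ofFn.2 fun _ _ h => (blockEntry_inj h).2

theorem isCycle_tau (i : Fin k) : (tau p k a₀ i).IsCycle :=
  List.isCycle_formPerm (nodup_block i) (by simpa using (Fact.out : p.Prime).two_le)

theorem support_tau (i : Fin k) :
    (tau p k a₀ i).support = (List.ofFn (blockEntry p k a₀ i)).toFinset := by
  refine List.support_formPerm_of_nodup _ (nodup_block i) fun x hx => ?_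
  have h := congrArg List.length hx
  have := (Fact.out : p.Prime).two_le
  simp at h
  omega

theorem card_support_tau (i : Fin k) : (tau p k a₀ i).support.card = p := by
  rw [support_tau, List.toFinset_card_of_nodup (nodup_block i), List.length_ofFn]

theorem tau_pow (i : Fin k) : tau p k a₀ i ^ p = 1 := by
  have h := (isCycle_tau (p := p) (a₀ := a₀) i).orderOf
  rw [card_support_tau] at h
  exact orderOf_dvd_iff_pow_eq_one.1 h.dvd

theorem disjoint_tau {i j : Fin k} (hij : i ≠ j) : (tau p k a₀ i).Disjoint (tau p k a₀ j) := by
  have : NeZero p := ⟨(Fact.out : p.Prime).ne_zero⟩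
  rw [Equiv.Perm.disjoint_iff_disjoint_support, support_tau, support_tau, Finset.disjoint_left]
  intro x hx hx'
  rw [List.mem_toFinset, List.mem_ofFn'] at hx hx'
  obtain ⟨a, rfl⟩ := hx
  obtain ⟨c, hc⟩ := hx'
  exact hij (blockEntry_inj hc).1.symm

theorem cycleGroup_mul_comm (a b : cycleGroup p k a₀) : a * b = b * a := by
  refine Subtype.ext ?_
  refine Subgroup.closure_induction₂ (p := fun x y _ _ => x * y = y * x) ?_ ?_ ?_ ?_ ?_ ?_ ?_
    a.2 b.2
  · rintro _ _ ⟨i, rfl⟩ ⟨j, rfl⟩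
    by_cases hij : i = j
    · rw [hij]
    · exact (disjoint_tau hij).commute
  · intro x _
    rw [one_mul, mul_one]
  · intro x _
    rw [one_mul, mul_one]
  · intro x y z _ _ _ h1 h2
    exact Commute.mul_left h1 h2
  · intro x y z _ _ _ h1 h2
    exact Commute.mul_right h1 h2
  · intro x y _ _ h
    exact Commute.inv_left h
  · intro x y _ _ h
    exact Commute.inv_right h

theorem cycleGroup_pow (a : cycleGroup p k a₀) : a ^ p = 1 := by
  obtain ⟨a, ha⟩ := a
  refine Subtype.ext ?_
  change a ^ p = 1
  induction ha using Subgroup.closure_induction with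
  | mem x hx =>
    obtain ⟨i, rfl⟩ := hx
    exact tau_pow i
  | one => exact one_pow p
  | mul x y hx hy h1 h2 =>
    have hc : Commute x y :=
      congrArg Subtype.val (cycleGroup_mul_comm (⟨x, hx⟩ : cycleGroup p k a₀) ⟨y, hy⟩)
    rw [hc.mul_pow, h1, h2, one_mul]
  | inv x _ h => rw [inv_pow, h, inv_one]

theorem tauMem_pow (i : Fin k) : tauMem p k a₀ i ^ p = 1 := cycleGroup_pow _

theorem tauMem_ne_one (i : Fin k) : tauMem p k a₀ i ≠ 1 := fun h =>
  (isCycle_tau i).ne_one (congrArg Subtype.val h)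

/-- An element of the group generated by the other cycles fixes the block of `τ_i` pointwise. -/
theorem apply_eq_of_mem_closure_compl {i : Fin k} {h : cycleGroup p k a₀}
    (hh : h ∈ Subgroup.closure (tauMem p k a₀ '' {i}ᶜ)) {x : Fin (k * p + a₀)}
    (hx : tau p k a₀ i x ≠ x) : h.1 x = x := by
  induction hh using Subgroup.closure_induction with
  | mem y hy =>
    obtain ⟨j, hj, rfl⟩ := hy
    exact ((disjoint_tau (p := p) (a₀ := a₀) (Ne.symm hj) x).resolve_left hx)
  | one => rfl
  | mul a b _ _ ha hb =>
    change a.1 (b.1 x) = x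
    rw [hb, ha]
  | inv a _ ha => exact Equiv.Perm.inv_eq_iff_eq.2 ha.symm

/-- On the block of `τ_i`, an element of `P` acts as a power of `τ_i`. -/
theorem exists_zpow_of_mem_cycleGroup {g : Equiv.Perm (Fin (k * p + a₀))}
    (hg : g ∈ cycleGroup p k a₀) (i : Fin k) :
    ∃ m : ℤ, ∀ x, tau p k a₀ i x ≠ x → g x = (tau p k a₀ i ^ m) x := by
  have hmem : ∀ (m : ℤ) x, tau p k a₀ i x ≠ x →
      tau p k a₀ i ((tau p k a₀ i ^ m) x) ≠ (tau p k a₀ i ^ m) x := fun m x hx => by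
    rw [← Equiv.Perm.mem_support] at hx ⊢
    exact Equiv.Perm.zpow_apply_mem_support.2 hx
  induction hg using Subgroup.closure_induction with
  | mem y hy =>
    obtain ⟨j, rfl⟩ := hy
    by_cases hij : i = j
    · subst hij
      exact ⟨1, fun x _ => rfl⟩
    · exact ⟨0, fun x hx => (disjoint_tau hij x).resolve_left hx⟩
  | one => exact ⟨0, fun _ _ => rfl⟩
  | mul a b _ _ ha hb =>
    obtain ⟨m, hm⟩ := ha
    obtain ⟨l, hl⟩ := hb
    refine ⟨m + l, fun x hx => ?_⟩
    rw [Equiv.Perm.mul_apply, hl x hx, hm _ (hmem l x hx), zpow_add, Equiv.Perm.mul_apply]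
  | inv a _ ha =>
    obtain ⟨m, hm⟩ := ha
    refine ⟨-m, fun x hx => ?_⟩
    rw [Equiv.Perm.inv_eq_iff_eq, hm _ (hmem _ x hx), ← Equiv.Perm.mul_apply, ← zpow_add,
      add_neg_cancel]
    rfl

theorem exists_tau_apply_ne {g : Equiv.Perm (Fin (k * p + a₀))} (hg : g ∈ cycleGroup p k a₀)
    {x : Fin (k * p + a₀)} (hx : g x ≠ x) : ∃ i, tau p k a₀ i x ≠ x := by
  by_contra! h
  refine hx ?_
  clear hx
  induction hg using Subgroup.closure_induction with
  | mem y hy =>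
    obtain ⟨j, rfl⟩ := hy
    exact h j
  | one => rfl
  | mul a b _ _ ha hb =>
    rw [Equiv.Perm.mul_apply, hb, ha]
  | inv a _ ha =>
    exact Equiv.Perm.inv_eq_iff_eq.2 ha.symm

end Cycles

/-! ### Stabilizers of tabloids -/

section Stabilizers

variable {r s n : ℕ} {lam : Fin r → ℕ} {mu : Fin s → ℕ}

/-- The tabloid of a tableau. -/
def Tableau.tabloid (t : Tableau lam mu n) : Tabloid lam mu n := Quotient.mk _ t

theorem exists_tabloid_eq (T : Tabloid lam mu n) : ∃ t : Tableau lam mu n, t.tabloid = T :=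
  Quotient.exists_rep T

/-- Equivalent tableaux differ by a row permutation, and a permutation is determined by its effect
on the entries of `t`. -/
theorem smul_tabloid_eq_iff {t : Tableau lam mu n} {π : Equiv.Perm (Fin n)} :
    π • t.tabloid = t.tabloid ↔
      ∀ x, t.row (π x) = t.row x := by
  constructor
  · intro h
    obtain ⟨ρ, hρ, he⟩ := (Quotient.exact h.symm : t ≈ π • t)
    have : π = ρ := by
      ext1 x
      obtain ⟨c, rfl, -⟩ := t.exists_entry x
      exact congrArg (fun u : Tableau lam mu n => u.entry c) he
    exact this ▸ hρ
  · intro h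
    exact (Quotient.sound ⟨π, h, rfl⟩ : t.tabloid = (π • t).tabloid).symm

variable (K : Type*) [Field K]

/-- The signed action multiplies the permuted tabloid by `±1`, so the condition is purely
combinatorial and independent of `K`. -/
theorem fixedUpToSign_iff {π : Equiv.Perm (Fin n)} {T : Tabloid lam mu n} :
    FixedUpToSign K π T ↔ π • T = T := by
  unfold FixedUpToSign
  rw [signedModule_single]
  constructor
  · intro h
    by_contra hne
    have h0 : ∀ c : K, (Finsupp.single (π • T) c : Tabloid lam mu n →₀ K) T = 0 := fun c =>
      Finsupp.single_eq_of_ne' hne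
    rcases h with h | h
    · have := congrArg (fun f => f T) h
      simp [h0] at this
    · have := congrArg (fun f => f T) h
      simp [h0] at this
  · intro h
    rw [h]
    rcases Int.units_eq_one_or (Tabloid.actionSign π T) with h1 | h1
    · left
      simp [h1]
    · right
      simp [h1]

theorem ncard_fixed_eq_of_isConj {G X : Type*} [Group G] [MulAction G X] {g h : G}
    (hgh : IsConj g h) : {x : X | g • x = x}.ncard = {x : X | h • x = x}.ncard := by
  obtain ⟨c, hc⟩ := isConj_iff.1 hgh
  rw [← Set.ncard_image_of_injective _ (MulAction.injective c)]
  congr 1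
  ext x
  constructor
  · rintro ⟨y, hy, rfl⟩
    change h • c • y = c • y
    rw [← hc, mul_smul, mul_smul, inv_smul_smul, hy]
  · intro hx
    refine ⟨c⁻¹ • x, ?_, smul_inv_smul c x⟩
    change g • c⁻¹ • x = c⁻¹ • x
    have hx : h • x = x := hx
    rw [← hc, mul_smul, mul_smul] at hx
    rw [eq_inv_smul_iff, hx]

variable {p k a₀ : ℕ}

/-- If a permutation that acts on the block of `τ_i` as a power of `τ_i` fixes a tabloid, then so
does this power. -/
theorem zpow_tau_smul_eq {T : Tabloid lam mu (k * p + a₀)} {i : Fin k} {m : ℤ}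
    {g : Equiv.Perm (Fin (k * p + a₀))}
    (hg : ∀ x, tau p k a₀ i x ≠ x → g x = (tau p k a₀ i ^ m) x) (hT : g • T = T) :
    tau p k a₀ i ^ m • T = T := by
  obtain ⟨t, rfl⟩ := exists_tabloid_eq T
  rw [smul_tabloid_eq_iff] at hT ⊢
  intro x
  by_cases hx : tau p k a₀ i x = x
  · rw [Equiv.Perm.zpow_apply_eq_self_of_apply_eq_self hx]
  · rw [← hg x hx, hT]

theorem mem_constitutingBlocks {T : Tabloid lam mu (k * p + a₀)} {i : Fin k} :
    i ∈ constitutingBlocks K T ↔ tauMem p k a₀ i • T ≠ T := by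
  classical
  simp only [constitutingBlocks, Finset.mem_filter, Finset.mem_univ, true_and, fixedUpToSign_iff]
  rfl

variable [Fact p.Prime]

/-- All `τ_i` are `p`-cycles, hence conjugate in the full symmetric group, which acts on all
tabloids. -/
theorem ncard_fixed_tau (i j : Fin k) :
    {T : Tabloid lam mu (k * p + a₀) | tau p k a₀ i • T = T}.ncard =
      {T : Tabloid lam mu (k * p + a₀) | tau p k a₀ j • T = T}.ncard :=
  ncard_fixed_eq_of_isConj
    ((isCycle_tau i).isConj (isCycle_tau j) (by rw [card_support_tau, card_support_tau]))

/-- A nontrivial element of `P` that fixes tabloids determines a cycle `τ_i` that fixes them. -/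
theorem exists_tauMem_smul_eq {h : cycleGroup p k a₀} (hh : h ≠ 1) :
    ∃ i, ∀ T : Tabloid lam mu (k * p + a₀), h • T = T → tauMem p k a₀ i • T = T := by
  obtain ⟨x, hx⟩ : ∃ x, h.1 x ≠ x := by
    by_contra! hx
    exact hh (Subtype.ext (Equiv.ext hx))
  obtain ⟨i, hi⟩ := exists_tau_apply_ne h.2 hx
  obtain ⟨m, hm⟩ := exists_zpow_of_mem_cycleGroup h.2 i
  -- The index `i` is chosen from `h` alone, so one cycle serves all entries of a tuple fixed by
  -- `h`.
  refine ⟨i, fun T hT => ?_⟩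
  have h1 := zpow_tau_smul_eq (T := T) hm hT
  -- If `p` divided `m`, then `h` would fix the letter `x` that it moves.
  refine smul_eq_of_zpow_smul_eq (g := tau p k a₀ i) (tau_pow i) (fun hd => hx ?_) h1
  obtain ⟨c, rfl⟩ := hd
  rw [hm x hi, zpow_mul, zpow_natCast, tau_pow, one_zpow]
  rfl

theorem card_orbit_tabloid (T : Tabloid lam mu (k * p + a₀)) :
    Nat.card (MulAction.orbit (cycleGroup p k a₀) T) = p ^ (constitutingBlocks K T).card := by
  refine card_orbit_of_generators cycleGroup_mul_comm (tauMem p k a₀) closure_range_tauMem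
    tauMem_pow (fun i m h hh hT => ?_) _ fun i => mem_constitutingBlocks K
  -- The factor `h` fixes the block of `τ_i` pointwise, so the product acts there as `τ_i ^ m`.
  refine zpow_tau_smul_eq (g := ((tauMem p k a₀ i ^ m * h : cycleGroup p k a₀) :
    Equiv.Perm (Fin (k * p + a₀)))) (fun x hx => ?_) hT
  change (tau p k a₀ i ^ m) (h.1 x) = _
  rw [apply_eq_of_mem_closure_compl hh hx]

end Stabilizers

/-! ### The signed permutation module restricted to `P` -/

section Restriction

variable {K : Type*} [Field K] {p k a₀ r s : ℕ} {lam : Fin r → ℕ} {mu : Fin s → ℕ}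

theorem restrictedModule_single (g : cycleGroup p k a₀) (T : Tabloid lam mu (k * p + a₀)) :
    ∃ u : K, restrictedModule p k a₀ K lam mu g (Finsupp.basisSingleOne (R := K) T) =
      u • Finsupp.basisSingleOne (R := K) (g • T) := by
  refine ⟨((Tabloid.actionSign g.1 T : ℤˣ) : ℤ), ?_⟩
  rw [Finsupp.coe_basisSingleOne, Finsupp.smul_single, smul_eq_mul, mul_one]
  exact signedModule_single lam mu _ K g.1 T

/-- The basis of `M_P` that consists of the tabloids. -/
noncomputable def tabloidBasis (p k a₀ : ℕ) (K : Type*) [Field K] {r s : ℕ} (lam : Fin r → ℕ)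
    (mu : Fin s → ℕ) :
    Module.Basis (Tabloid lam mu (k * p + a₀)) K (restrictedModule p k a₀ K lam mu).asModule :=
  asModuleBasis _ Finsupp.basisSingleOne

theorem tabloidBasis_apply (T : Tabloid lam mu (k * p + a₀)) :
    tabloidBasis p k a₀ K lam mu T =
      (restrictedModule p k a₀ K lam mu).asModuleEquiv.symm (Finsupp.single T 1) := by
  rw [tabloidBasis, asModuleBasis_apply, Finsupp.coe_basisSingleOne]

theorem isMonomial_tabloidBasis :
    IsMonomial (G := cycleGroup p k a₀) (N := (restrictedModule p k a₀ K lam mu).asModule)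
      (tabloidBasis p k a₀ K lam mu) :=
  isMonomial_asModuleBasis restrictedModule_single

theorem cyclicSubmodule_eq (T : Tabloid lam mu (k * p + a₀)) :
    cyclicSubmodule K T =
      Submodule.span (MonoidAlgebra K (cycleGroup p k a₀)) {tabloidBasis p k a₀ K lam mu T} := by
  rw [tabloidBasis_apply, cyclicSubmodule]

theorem finite_restrictedModule :
    Module.Finite K (restrictedModule p k a₀ K lam mu).asModule :=
  Module.Finite.of_basis (tabloidBasis p k a₀ K lam mu)

variable [Fact p.Prime]

theorem not_projective_of_notMem [CharP K p] {T : Tabloid lam mu (k * p + a₀)} {i : Fin k}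
    (hi : i ∉ constitutingBlocks K T) :
    ¬ Module.Projective (MonoidAlgebra K (cycleGroup p k a₀)) (cyclicSubmodule K T) := by
  have := Fintype.ofFinite (cycleGroup p k a₀)
  have := finite_restrictedModule (K := K) (p := p) (k := k) (a₀ := a₀) (lam := lam) (mu := mu)
  have hb := isMonomial_tabloidBasis (K := K) (p := p) (k := k) (a₀ := a₀) (lam := lam) (mu := mu)
  rw [cyclicSubmodule_eq]
  intro hproj
  have h := (hb.projective_iff cycleGroup_mul_comm cycleGroup_pow T).1 hproj
  rw [mem_constitutingBlocks, not_not] at hi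
  exact tauMem_ne_one i (h _ hi)

/-- In the commutative group `P`, `τ_i` fixes `g U` if and only if it fixes `U`. -/
theorem constitutingBlocks_congr {T U : Tabloid lam mu (k * p + a₀)}
    (h : T ∈ MulAction.orbit (cycleGroup p k a₀) U) :
    constitutingBlocks K T = constitutingBlocks K U := by
  obtain ⟨g, rfl⟩ := h
  ext i
  rw [mem_constitutingBlocks, mem_constitutingBlocks]
  change tauMem p k a₀ i • g • U ≠ g • U ↔ _
  rw [← mul_smul, cycleGroup_mul_comm, mul_smul, (MulAction.injective g).ne_iff]

theorem hasBensonSymondsInvariant_restrictedModule [CharP K p] (i : Fin k) :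
    HasBensonSymondsInvariant (restrictedModule p k a₀ K lam mu)
      {T : Tabloid lam mu (k * p + a₀) | FixedUpToSign K (tau p k a₀ i) T}.ncard := by
  refine hasBensonSymondsInvariant_of_monomial cycleGroup_mul_comm cycleGroup_pow
    (b := Finsupp.basisSingleOne) restrictedModule_single (Fin.pos i) (tauMem p k a₀)
    tauMem_ne_one (fun n f ⟨h, hne, hf⟩ => ?_) fun j => ?_
  · obtain ⟨j, hj⟩ := exists_tauMem_smul_eq (lam := lam) (mu := mu) hne
    exact ⟨j, funext fun l => hj _ (congrFun hf l)⟩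
  · simp only [fixedUpToSign_iff]
    exact ncard_fixed_tau j i

/-- The number of tabloids that are fixed up to sign by `τ_i`, as a sum over the orbits. -/
theorem sum_card_orbit_eq_ncard
    {t : TabloidOrbit p k a₀ lam mu → Tabloid lam mu (k * p + a₀)}
    (ht : ∀ α : TabloidOrbit p k a₀ lam mu, Quotient.mk _ (t α) = α) (i : Fin k)
    {J : Finset (TabloidOrbit p k a₀ lam mu)}
    (hJ : ∀ α, α ∈ J ↔ i ∉ constitutingBlocks K (t α)) :
    ∑ α ∈ J, p ^ (constitutingBlocks K (t α)).card =
      {T : Tabloid lam mu (k * p + a₀) | FixedUpToSign K (tau p k a₀ i) T}.ncard := by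
  classical
  have := Fintype.ofFinite (Tabloid lam mu (k * p + a₀))
  have hset : {T : Tabloid lam mu (k * p + a₀) | FixedUpToSign K (tau p k a₀ i) T} =
      ((J.biUnion fun α => (MulAction.orbit (cycleGroup p k a₀) (t α)).toFinset :
        Finset (Tabloid lam mu (k * p + a₀))) : Set (Tabloid lam mu (k * p + a₀))) := by
    ext T
    have hT : FixedUpToSign K (tau p k a₀ i) T ↔ i ∉ constitutingBlocks K T := by
      rw [mem_constitutingBlocks, not_not, fixedUpToSign_iff]
      rfl
    simp only [Set.mem_ofPred_eq, Finset.coe_biUnion, Set.mem_iUnion, Set.coe_toFinset, hT,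
      Finset.mem_coe]
    constructor
    · intro h
      have horb := (mk_eq_iff_mem_orbit ht (x := T)).1 rfl
      exact ⟨_, (hJ _).2 (constitutingBlocks_congr (K := K) horb ▸ h), horb⟩
    · rintro ⟨α, hα, horb⟩
      exact constitutingBlocks_congr (K := K) horb ▸ (hJ α).1 hα
  rw [hset, Set.ncard_coe_finset, Finset.card_biUnion]
  · refine Finset.sum_congr rfl fun α _ => ?_
    rw [← card_orbit_tabloid, Set.toFinset_card, Nat.card_eq_fintype_card]
  · intro α _ β _ hne
    refine Finset.disjoint_left.2 fun T hα hβ => ?_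
    rw [Set.mem_toFinset] at hα hβ
    exact hne (((mk_eq_iff_mem_orbit ht).2 hα).symm.trans ((mk_eq_iff_mem_orbit ht).2 hβ))

end Restriction

end SignedPerm

/-! ### The theorem -/

open SignedPerm in
theorem theorem4p1 {K : Type*} [Field K] {p : ℕ} [Fact p.Prime] [CharP K p]
    {k a₀ : ℕ} (hk : 1 ≤ k) (ha₀ : a₀ < p)
    {r s : ℕ} (lam : Fin r → ℕ) (mu : Fin s → ℕ)
    (hlam : IsPartition lam) (hmu : IsPartition mu)
    (hn : ∑ i, lam i + ∑ j, mu j = k * p + a₀)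
    -- a representative `t α` of each `P`-orbit `α` of tabloids; `A_α = ⟨t α⟩`
    (t : TabloidOrbit p k a₀ lam mu → Tabloid lam mu (k * p + a₀))
    (ht : ∀ α : TabloidOrbit p k a₀ lam mu, Quotient.mk _ (t α) = α)
    -- `J₀` is the largest set of non-projective summands whose constituting blocks lie in
    -- `{B_1, …, B_{k-1}}` (the block `B_{i+1}` has index `i : Fin k`)
    (J₀ : Finset (TabloidOrbit p k a₀ lam mu))
    (hJ₀ : IsGreatest {J : Finset (TabloidOrbit p k a₀ lam mu) | ∀ α ∈ J,
      ¬ Module.Projective (MonoidAlgebra K (cycleGroup p k a₀)) (cyclicSubmodule K (t α)) ∧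
        ∀ i ∈ constitutingBlocks K (t α), (i : ℕ) < k - 1} J₀) :
    -- `M_P` is the internal direct sum of the `A_α`
    (iSupIndep (fun α => cyclicSubmodule K (t α)) ∧ ⨆ α, cyclicSubmodule K (t α) = ⊤) ∧
    -- `A_α` is spanned by the orbit `α`, all of whose tabloids have the same constituting blocks;
    -- it is indecomposable of dimension `p ^ d_α`
    (∀ α : TabloidOrbit p k a₀ lam mu,
      (cyclicSubmodule K (t α)).restrictScalars K =
        Submodule.span K {v | ∃ T, (Quotient.mk _ T : TabloidOrbit p k a₀ lam mu) = α ∧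
          v = (restrictedModule p k a₀ K lam mu).asModuleEquiv.symm (Finsupp.single T 1)} ∧
      (∀ T, (Quotient.mk _ T : TabloidOrbit p k a₀ lam mu) = α →
        constitutingBlocks K T = constitutingBlocks K (t α)) ∧
      IsIndecomposable (cyclicSubmodule K (t α)) ∧
      dimension (cyclicSubmodule K (t α)) = p ^ (constitutingBlocks K (t α)).card) ∧
    -- the sum of the non-projective `A_α` is a core of `M_P`
    IsCore (⨆ α ∈ {α | ¬ Module.Projective (MonoidAlgebra K (cycleGroup p k a₀))
      (cyclicSubmodule K (t α))}, cyclicSubmodule K (t α)) ∧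
    -- `γ_P(M) = ∑_{α ∈ J₀} p ^ d_α`
    HasBensonSymondsInvariant (restrictedModule p k a₀ K lam mu)
      (∑ α ∈ J₀, (p : ℝ) ^ (constitutingBlocks K (t α)).card) ∧
    -- this is the number of tabloids fixed up to sign by `τ_k`
    ∑ α ∈ J₀, p ^ (constitutingBlocks K (t α)).card =
      {T : Tabloid lam mu (k * p + a₀) |
        FixedUpToSign K (tau p k a₀ ⟨k - 1, Nat.sub_lt hk Nat.one_pos⟩) T}.ncard := by
  have := Fintype.ofFinite (cycleGroup p k a₀)
  have := finite_restrictedModule (K := K) (p := p) (k := k) (a₀ := a₀) (lam := lam) (mu := mu)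
  have hb := isMonomial_tabloidBasis (K := K) (p := p) (k := k) (a₀ := a₀) (lam := lam) (mu := mu)
  let i : Fin k := ⟨k - 1, Nat.sub_lt hk Nat.one_pos⟩
  -- Here `i` is the index of the last block `B_k`. Nonprojectivity is automatic when `i` is missing
  -- from the constituting blocks, because `τ_k` is then a nontrivial stabilizer element.
  have hJ : ∀ α, α ∈ J₀ ↔ i ∉ constitutingBlocks K (t α) := by
    refine fun α => ⟨fun hα hi => lt_irrefl (k - 1) ((hJ₀.1 α hα).2 i hi), fun hi => ?_⟩
    -- The singleton `{α}` is itself an admissible set, so it lies in the greatest one.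
    suffices h : ({α} : Finset _) ⊆ J₀ from h (Finset.mem_singleton_self α)
    refine hJ₀.2 fun β hβ => ?_
    rw [Finset.mem_singleton.1 hβ]
    refine ⟨not_projective_of_notMem hi, fun j hj => ?_⟩
    have hne : (j : ℕ) ≠ k - 1 := fun h => hi ((Fin.ext h : j = i) ▸ hj)
    omega
  have hsum := sum_card_orbit_eq_ncard ht i hJ
  have horb : ∀ {α : TabloidOrbit p k a₀ lam mu} {T : Tabloid lam mu (k * p + a₀)},
      (Quotient.mk _ T : TabloidOrbit p k a₀ lam mu) = α ↔
        T ∈ MulAction.orbit (cycleGroup p k a₀) (t α) := mk_eq_iff_mem_orbit ht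
  refine ⟨?_, fun α => ⟨?_, fun T hT => constitutingBlocks_congr (horb.1 hT), ?_, ?_⟩, ?_, ?_, hsum⟩
  · simp only [cyclicSubmodule_eq]
    exact ⟨hb.iSupIndep ht, hb.iSup_eq_top ht⟩
  · rw [cyclicSubmodule_eq, hb.restrictScalars_span_singleton]
    congr 1
    ext v
    simp only [horb, ← tabloidBasis_apply]
    exact ⟨fun ⟨T, hT, hv⟩ => ⟨T, hT, hv.symm⟩, fun ⟨T, hT, hv⟩ => ⟨T, hT, hv.symm⟩⟩
  · rw [cyclicSubmodule_eq]
    exact isIndecomposable_span_singleton (N := (restrictedModule p k a₀ K lam mu).asModule)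
      cycleGroup_mul_comm cycleGroup_pow
      ((tabloidBasis p k a₀ K lam mu).ne_zero (t α))
  · rw [dimension, cyclicSubmodule_eq, hb.restrictScalars_span_singleton]
    refine (finrank_span_basis_image (tabloidBasis p k a₀ K lam mu) _).trans ?_
    rw [← Nat.card_coe_set_eq, card_orbit_tabloid K]
  · simp only [cyclicSubmodule_eq]
    exact hb.isCore_iSup cycleGroup_mul_comm cycleGroup_pow ht
  · have h := hasBensonSymondsInvariant_restrictedModule (K := K) (lam := lam) (mu := mu)
      (a₀ := a₀) i
    rw [← hsum] at h
    exact_mod_cast h
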